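/- Let $\Bbbk$ be a field of characteristic zero, $n\ge 1$ an integer and $a\in\Bbbk$. On $\Bbbk[X_0,\dots,X_n]$ consider the derivations $\Delta=\sum_{i=1}^{n}X_{i-1}\,\partial/\partial X_i$ and $\Gamma_a=\sum_{i=0}^{n}(a+i)X_i\,\partial/\partial X_i$. Let $R(n,a)$ be the associative algebra with underlying space $\Bbbk[X_0,\dots,X_n]$ and product $$f*_a g=\sum_{k\ge 0}\Delta^k(f)\,\binom{\Gamma_a}{k}(g),\qquad \binom{\Gamma_a}{k}=\tfrac1{k!}\Gamma_a(\Gamma_a-1)\cdots(\Gamma_a-(k-1)),$$ and let $A(n,a)$ be the Poisson algebra $\Bbbk[X_0,\dots,X_n]$ with bracket $\{f,g\}_a=\Delta(f)\Gamma_a(g)-\Gamma_a(f)\Delta(g)$. Both are graded by polynomial degree ($\deg X_i=1$). Let $\mathrm{Aut}_{gr}R(n,a)$ be the group of graded $\Bbbk$-algebra automorphisms of $R(n,a)$, and $\mathrm{PAut}_{gr}A(n,a)$ the group of graded $\Bbbk$-algebra automorphisms of $\Bbbk[X_0,\dots,X_n]$ that preserve $\{-,-\}_a$. **(1)** Assume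 $n\ge2$, or $n=1$ and $a\ne0$. For every $\lambda\in\Bbbk^\times$ there is an algebra automorphism $\xi_\lambda$ of $R(n,a)$ with $\xi_\lambda(X_j)=\lambda X_j$ for $0\le j\le n$, and for every $c\in\Bbbk$ there is an algebra automorphism $\phi_c$ of $R(n,a)$ with $\phi_c(X_j)=\sum_{\ell=0}^{j}\binom{c}{\ell}X_{j-\ell}$ for $0\le j\le n$. The graded automorphisms of $R(n,a)$ are exactly the maps $\xi_\lambda\phi_c$ with $\lambda\in\Bbbk^\times$, $c\in\Bbbk$, and $(\lambda,c)\mapsto\xi_\lambda\phi_c$ is a group isomorphism $\Bbbk^\times\times\Bbbk\cong\mathrm{Aut}_{gr}R(n,a)$, where $\Bbbk$ is the additive group. Moreover $$\mathrm{PAut}_{gr}A(n,a)\cong\Bbbk^\times\times\Bbbk\cong\mathrm{Aut}_{gr}R(n,a).$$ **(2)** If $n=1$ and $a=0$, then $\mathrm{PAut}_{gr}A(1,0)=\mathrm{Aut}_{gr}\Bbbk[X_0,X_1]$; there is an algebra isomorphism $R(1,0)\cong\Bbbk[X_0,X_1]$ with $X_0\mapsto X_0$, $X_1\mapsto X_1$,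 and under it $\mathrm{Aut}_{gr}R(1,0)$ is identified with $\mathrm{Aut}_{gr}\Bbbk[X_0,X_1]$. This group is isomorphic to $\mathrm{GL}_2(\Bbbk)$. -/

import Mathlib

noncomputable section

namespace PymAlgebra

variable (𝕜 : Type*) [Field 𝕜] (n : ℕ)

/-- The commutative polynomial ring `𝕜[X_0, …, X_n]`. -/
abbrev Poly : Type _ := MvPolynomial (Fin (n + 1)) 𝕜

/-- The downward derivation `Δ = X_0 ∂_1 + … + X_{n-1} ∂_n`: `Δ X_0 = 0` and `Δ X_{j+1} = X_j`. -/
def downDer : Derivation 𝕜 (Poly 𝕜 n) (Poly 𝕜 n) :=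
  MvPolynomial.mkDerivation 𝕜
    (Fin.cases 0 (fun j : Fin n => (MvPolynomial.X j.castSucc : Poly 𝕜 n)))

variable {𝕜}

/-- The weighted Euler derivation `Γ_a = ∑ (a + i) X_i ∂_i`. -/
def eulerDer (a : 𝕜) : Derivation 𝕜 (Poly 𝕜 n) (Poly 𝕜 n) :=
  MvPolynomial.mkDerivation 𝕜
    (fun i : Fin (n + 1) => (a + ((i : ℕ) : 𝕜)) • (MvPolynomial.X i : Poly 𝕜 n))

/-- The binomial coefficient `c (c - 1) ⋯ (c - (k - 1)) / k!` of a scalar `c`. -/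
def binom (c : 𝕜) (k : ℕ) : 𝕜 :=
  (k.factorial : 𝕜)⁻¹ * (descPochhammer 𝕜 k).eval c

/-- The operator `Γ_a (Γ_a - 1) ⋯ (Γ_a - (k - 1)) / k!`. -/
def binomEuler (a : 𝕜) (k : ℕ) : Module.End 𝕜 (Poly 𝕜 n) :=
  (k.factorial : 𝕜)⁻¹ •
    Polynomial.aeval ((eulerDer n a : Poly 𝕜 n →ₗ[𝕜] Poly 𝕜 n) : Module.End 𝕜 (Poly 𝕜 n))
      (descPochhammer 𝕜 k)

/-- The powers `Δ ^ k` as linear operators. -/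
def downPow (k : ℕ) : Module.End 𝕜 (Poly 𝕜 n) :=
  ((downDer 𝕜 n : Poly 𝕜 n →ₗ[𝕜] Poly 𝕜 n) : Module.End 𝕜 (Poly 𝕜 n)) ^ k

/-- The product `f ∗_a g = ∑_{k ≥ 0} Δ^k(f) · binom(Γ_a, k)(g)`; the sum is finite since `Δ` is
locally nilpotent (`exists_downPow_eq_zero`). -/
def star (a : 𝕜) (f g : Poly 𝕜 n) : Poly 𝕜 n :=
  ∑ᶠ k : ℕ, downPow n k f * binomEuler n a k g

/-- The bracket `{f, g}_a = Δ(f) Γ_a(g) - Γ_a(f) Δ(g)` of the Poisson algebra `A(n,a)`. -/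
def bracket (a : 𝕜) (f g : Poly 𝕜 n) : Poly 𝕜 n :=
  downDer 𝕜 n f * eulerDer n a g - eulerDer n a f * downDer 𝕜 n g

/-! ### The product `∗_a` is associative and unital -/

variable {n}

theorem downPow_zero (f : Poly 𝕜 n) : downPow n 0 f = f := rfl

theorem downPow_succ (k : ℕ) (f : Poly 𝕜 n) :
    downPow n (k + 1) f = downDer 𝕜 n (downPow n k f) := by
  rw [downPow, pow_succ']; rfl

theorem downPow_add (j k : ℕ) (f : Poly 𝕜 n) :
    downPow n (j + k) f = downPow n j (downPow n k f) := by
  rw [downPow, pow_add]; rfl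

theorem downPow_mul (m : ℕ) (f g : Poly 𝕜 n) :
    downPow n m (f * g) = ∑ p ∈ Finset.HasAntidiagonal.antidiagonal m,
      (m.choose p.1) • (downPow n p.1 f * downPow n p.2 g) := by
  induction m with
  | zero => simp [downPow_zero]
  | succ m ih =>
    rw [Finset.sum_antidiagonal_choose_succ_nsmul
      (M := Poly 𝕜 n) (fun i j => downPow n i f * downPow n j g) m]
    simp only [downPow_succ, ih, map_sum, map_nsmul, Derivation.leibniz, smul_eq_mul, smul_add,
      Finset.sum_add_distrib]
    congr 1
    refine Finset.sum_congr rfl fun ⟨i, j⟩ hij => ?_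
    rw [m.choose_symm_of_eq_add (Finset.HasAntidiagonal.mem_antidiagonal.1 hij).symm, mul_comm]

theorem downPow_eq_zero_of_le {f : Poly 𝕜 n} {N k : ℕ} (h : downPow n N f = 0) (hk : N ≤ k) :
    downPow n k f = 0 := by
  obtain ⟨j, rfl⟩ := Nat.exists_eq_add_of_le' hk
  rw [downPow_add, h, map_zero]

theorem downPow_X (i : Fin (n + 1)) : downPow n ((i : ℕ) + 1) (MvPolynomial.X i : Poly 𝕜 n) = 0 := by
  induction i using Fin.induction with
  | zero => simp [downPow_succ, downPow_zero, downDer]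
  | succ j ih =>
    have : downPow n 1 (MvPolynomial.X j.succ : Poly 𝕜 n) = MvPolynomial.X j.castSucc := by
      simp [downPow_succ, downPow_zero, downDer]
    rw [downPow_add, this]
    simpa using ih

/-- `Δ` is locally nilpotent. -/
theorem exists_downPow_eq_zero (f : Poly 𝕜 n) : ∃ N, downPow n N f = 0 := by
  induction f using MvPolynomial.induction_on with
  | C c => exact ⟨1, by simp [downPow_succ, downPow_zero]⟩
  | add p q hp hq =>
    obtain ⟨N, hN⟩ := hp
    obtain ⟨M, hM⟩ := hq
    exact ⟨N + M, by rw [map_add, downPow_eq_zero_of_le hN (by omega),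
      downPow_eq_zero_of_le hM (by omega), add_zero]⟩
  | mul_X p i hp =>
    obtain ⟨N, hN⟩ := hp
    refine ⟨N + (i + 1), ?_⟩
    rw [downPow_mul]
    refine Finset.sum_eq_zero fun x hx => ?_
    have hx' := Finset.HasAntidiagonal.mem_antidiagonal.1 hx
    rcases le_or_gt N x.1 with h | h
    · rw [downPow_eq_zero_of_le hN h, zero_mul, smul_zero]
    · rw [downPow_eq_zero_of_le (downPow_X i) (by omega), mul_zero, smul_zero]

theorem star_eq_sum (a : 𝕜) {f : Poly 𝕜 n} {N : ℕ} (h : downPow n N f = 0) (g : Poly 𝕜 n) :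
    star n a f g = ∑ k ∈ Finset.range N, downPow n k f * binomEuler n a k g := by
  refine finsum_eq_sum_of_support_subset _ fun k hk => ?_
  by_contra hk'
  refine hk ?_
  simp only [Finset.coe_range, Set.mem_Iio, not_lt] at hk'
  simp only [downPow_eq_zero_of_le h hk', zero_mul]

theorem star_add (a : 𝕜) (f g h : Poly 𝕜 n) :
    star n a f (g + h) = star n a f g + star n a f h := by
  obtain ⟨N, hN⟩ := exists_downPow_eq_zero f
  simp only [star_eq_sum a hN, map_add, mul_add, Finset.sum_add_distrib]

theorem add_star (a : 𝕜) (f g h : Poly 𝕜 n) :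
    star n a (f + g) h = star n a f h + star n a g h := by
  obtain ⟨N, hN⟩ := exists_downPow_eq_zero f
  obtain ⟨M, hM⟩ := exists_downPow_eq_zero g
  have hN' := downPow_eq_zero_of_le hN (Nat.le_add_right N M)
  have hM' := downPow_eq_zero_of_le hM (Nat.le_add_left M N)
  have hs : downPow n (N + M) (f + g) = 0 := by rw [map_add, hN', hM', add_zero]
  simp only [star_eq_sum a hN', star_eq_sum a hM', star_eq_sum a hs, map_add, add_mul,
    Finset.sum_add_distrib]

theorem star_smul (a c : 𝕜) (f g : Poly 𝕜 n) :
    star n a f (c • g) = c • star n a f g := by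
  obtain ⟨N, hN⟩ := exists_downPow_eq_zero f
  simp only [star_eq_sum a hN, map_smul, mul_smul_comm, Finset.smul_sum]

theorem smul_star (a c : 𝕜) (f g : Poly 𝕜 n) :
    star n a (c • f) g = c • star n a f g := by
  obtain ⟨N, hN⟩ := exists_downPow_eq_zero f
  have hs : downPow n N (c • f) = 0 := by rw [map_smul, hN, smul_zero]
  simp only [star_eq_sum a hN, star_eq_sum a hs, map_smul, smul_mul_assoc, Finset.smul_sum]

theorem star_zero (a : 𝕜) (f : Poly 𝕜 n) : star n a f 0 = 0 := by
  simpa using star_smul a 0 f 0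

theorem zero_star (a : 𝕜) (f : Poly 𝕜 n) : star n a 0 f = 0 := by
  simpa using smul_star a 0 0 f

theorem star_sum {ι : Type*} (a : 𝕜) (s : Finset ι) (f : Poly 𝕜 n) (g : ι → Poly 𝕜 n) :
    star n a f (∑ i ∈ s, g i) = ∑ i ∈ s, star n a f (g i) := by
  classical
  induction s using Finset.induction_on with
  | empty => simp [star_zero]
  | insert i s hi ih => rw [Finset.sum_insert hi, Finset.sum_insert hi, star_add, ih]

/-- On a `z`-eigenvector of `Γ_a` the operator `binom(Γ_a, k)` is multiplication by
`binom(z, k)`. -/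
theorem binomEuler_apply {a z : 𝕜} {g : Poly 𝕜 n} (hg : eulerDer n a g = z • g) (k : ℕ) :
    binomEuler n a k g = binom z k • g := by
  rw [binomEuler, LinearMap.smul_apply,
    Module.End.aeval_apply_of_mem_apply_eq_smul (μ := z) (by exact hg), smul_smul, binom]

theorem eulerDer_mul {a z w : 𝕜} {g h : Poly 𝕜 n} (hg : eulerDer n a g = z • g)
    (hh : eulerDer n a h = w • h) : eulerDer n a (g * h) = (z + w) • (g * h) := by
  simp only [Derivation.leibniz, hg, hh, smul_eq_mul, add_smul, mul_smul_comm, mul_comm h g]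
  abel

theorem eulerDer_down (a : 𝕜) (f : Poly 𝕜 n) :
    eulerDer n a (downDer 𝕜 n f) = downDer 𝕜 n (eulerDer n a f) - downDer 𝕜 n f := by
  have h : ⁅downDer 𝕜 n, eulerDer n a⁆ = downDer 𝕜 n := by
    refine MvPolynomial.derivation_ext fun i => ?_
    induction i using Fin.cases with
    | zero => simp [Derivation.commutator_apply, downDer, eulerDer]
    | succ j =>
      simp only [Derivation.commutator_apply, downDer, eulerDer, MvPolynomial.mkDerivation_X,
        Derivation.map_smul, Fin.cases_succ, Fin.val_succ, Fin.val_castSucc, Nat.cast_add, Nat.cast_one]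
      rw [← sub_smul]
      simp
  have := congrArg (fun D => D f) h
  simp only [Derivation.commutator_apply] at this
  rw [eq_sub_iff_add_eq, ← eq_sub_iff_add_eq']
  exact this.symm

theorem eulerDer_downPow {a z : 𝕜} {g : Poly 𝕜 n} (hg : eulerDer n a g = z • g) (k : ℕ) :
    eulerDer n a (downPow n k g) = (z - k) • downPow n k g := by
  induction k with
  | zero => simpa [downPow_zero] using hg
  | succ k ih =>
    rw [downPow_succ, eulerDer_down, ih, Derivation.map_smul, Nat.cast_succ, ← sub_sub, sub_smul _ (1 : 𝕜),
      one_smul]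

theorem exists_eulerDer_monomial (a : 𝕜) (s : Fin (n + 1) →₀ ℕ) :
    ∃ z : 𝕜, ∀ c : 𝕜, eulerDer n a (MvPolynomial.monomial s c) =
      z • (MvPolynomial.monomial s c : Poly 𝕜 n) := by
  suffices h : ∃ z : 𝕜, eulerDer n a (MvPolynomial.monomial s 1) =
      z • (MvPolynomial.monomial s 1 : Poly 𝕜 n) by
    obtain ⟨z, hz⟩ := h
    refine ⟨z, fun c => ?_⟩
    have : (MvPolynomial.monomial s c : Poly 𝕜 n) = c • MvPolynomial.monomial s 1 := by
      rw [MvPolynomial.smul_monomial, smul_eq_mul, mul_one]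
    rw [this, Derivation.map_smul, hz, smul_comm]
  induction s using Finsupp.induction_linear with
  | zero => exact ⟨0, by simp⟩
  | add s t hs ht =>
    obtain ⟨z, hz⟩ := hs
    obtain ⟨w, hw⟩ := ht
    refine ⟨z + w, ?_⟩
    have := eulerDer_mul hz hw
    rwa [MvPolynomial.monomial_mul, one_mul] at this
  | single i m =>
    induction m with
    | zero => exact ⟨0, by simp⟩
    | succ m ih =>
      obtain ⟨z, hz⟩ := ih
      have hX : eulerDer n a (MvPolynomial.monomial (Finsupp.single i 1) 1) =
          (a + ((i : ℕ) : 𝕜)) • (MvPolynomial.monomial (Finsupp.single i 1) 1 : Poly 𝕜 n) :=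
        MvPolynomial.mkDerivation_X _ _ _
      refine ⟨z + (a + ((i : ℕ) : 𝕜)), ?_⟩
      have := eulerDer_mul hz hX
      rwa [MvPolynomial.monomial_mul, one_mul, ← Finsupp.single_add] at this

theorem sum_antidiagonal_trunc {M : Type*} [AddCommMonoid M] (G : ℕ × ℕ → M) (N K : ℕ)
    (hG : ∀ p, N ≤ p.1 ∨ K ≤ p.2 → G p = 0) :
    ∑ m ∈ Finset.range (N + K), ∑ p ∈ Finset.HasAntidiagonal.antidiagonal m, G p =
      ∑ p ∈ Finset.range N ×ˢ Finset.range K, G p := by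
  rw [← Finset.sum_fiberwise_of_maps_to (s := Finset.range N ×ˢ Finset.range K)
    (t := Finset.range (N + K)) (g := fun p => p.1 + p.2)]
  · refine Finset.sum_congr rfl fun m _ => ?_
    symm
    refine Finset.sum_subset ?_ ?_
    · intro p hp
      simp only [Finset.mem_filter] at hp
      exact Finset.HasAntidiagonal.mem_antidiagonal.2 hp.2
    · intro p hp hp'
      refine hG p ?_
      simp only [Finset.mem_filter, Finset.mem_product, Finset.mem_range,
        Finset.HasAntidiagonal.mem_antidiagonal] at hp hp'
      omega
  · intro p hp
    simp only [Finset.mem_product, Finset.mem_range] at hp ⊢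
    omega

/-- The operator `∑_{k < N} binom(z, k) Δ^k`. -/
def phiTrunc (z : 𝕜) (N : ℕ) (f : Poly 𝕜 n) : Poly 𝕜 n :=
  ∑ k ∈ Finset.range N, binom z k • downPow n k f

theorem star_eigen {a z : 𝕜} {f g : Poly 𝕜 n} {N : ℕ} (hf : downPow n N f = 0)
    (hg : eulerDer n a g = z • g) : star n a f g = phiTrunc z N f * g := by
  rw [star_eq_sum a hf, phiTrunc, Finset.sum_mul]
  refine Finset.sum_congr rfl fun k _ => ?_
  rw [binomEuler_apply hg, mul_smul_comm, smul_mul_assoc]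

theorem downPow_phiTrunc (z : 𝕜) {N k : ℕ} {f : Poly 𝕜 n} (hf : downPow n N f = 0) (hk : N ≤ k) :
    downPow n k (phiTrunc z N f) = 0 := by
  rw [phiTrunc, map_sum]
  refine Finset.sum_eq_zero fun j _ => ?_
  rw [map_smul, ← downPow_add, downPow_eq_zero_of_le hf (by omega), smul_zero]

theorem phiTrunc_trunc (z : 𝕜) {N M : ℕ} {f : Poly 𝕜 n} (hf : downPow n N f = 0) (hM : N ≤ M) :
    phiTrunc z M f = phiTrunc z N f := by
  rw [phiTrunc, phiTrunc]
  symm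
  refine Finset.sum_subset (Finset.range_mono hM) fun k _ hk => ?_
  rw [downPow_eq_zero_of_le hf (by simpa using hk), smul_zero]

section CharZero

variable [CharZero 𝕜]

theorem binom_eq_choose (c : 𝕜) (k : ℕ) : binom c k = Ring.choose c k := by
  rw [Ring.choose_eq_smul, binom, smul_eq_mul, ← descPochhammer_map (Int.castRingHom 𝕜) k,
    Polynomial.eval_map, Polynomial.eval₂_eq_sum, Polynomial.smeval_eq_sum]
  congr 1
  refine Finset.sum_congr rfl fun i _ => ?_
  simp [Polynomial.smul_pow]

theorem phiTrunc_comp (z w : 𝕜) {N : ℕ} {f : Poly 𝕜 n} (hf : downPow n N f = 0) :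
    phiTrunc w N (phiTrunc z N f) = phiTrunc (w + z) N f := by
  rw [← phiTrunc_trunc (w + z) hf (Nat.le_add_right N N)]
  have h1 : phiTrunc (w + z) (N + N) f = ∑ m ∈ Finset.range (N + N),
      ∑ p ∈ Finset.HasAntidiagonal.antidiagonal m, (binom w p.1 * binom z p.2) • downPow n (p.1 + p.2) f := by
    refine Finset.sum_congr rfl fun m _ => ?_
    rw [binom_eq_choose, Ring.add_choose_eq m (Commute.all w z), Finset.sum_smul]
    refine Finset.sum_congr rfl fun p hp => ?_
    rw [Finset.HasAntidiagonal.mem_antidiagonal.1 hp, binom_eq_choose, binom_eq_choose]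
  rw [h1, sum_antidiagonal_trunc, Finset.sum_product]
  · rw [phiTrunc]
    refine Finset.sum_congr rfl fun k _ => ?_
    rw [phiTrunc, map_sum, Finset.smul_sum]
    refine Finset.sum_congr rfl fun j _ => ?_
    rw [map_smul, smul_smul, downPow_add]
  · rintro p (h | h) <;> rw [downPow_eq_zero_of_le hf (by omega), smul_zero]

theorem phiTrunc_mul (w : 𝕜) {N K : ℕ} {F g : Poly 𝕜 n} (hF : downPow n N F = 0)
    (hg : downPow n K g = 0) :
    phiTrunc w (N + K) (F * g) =
      ∑ q ∈ Finset.range K, binom w q • (phiTrunc (w - q) N F * downPow n q g) := by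
  have h1 : phiTrunc w (N + K) (F * g) = ∑ m ∈ Finset.range (N + K),
      ∑ p ∈ Finset.HasAntidiagonal.antidiagonal m,
        (binom w p.2 * binom (w - p.2) p.1) • (downPow n p.1 F * downPow n p.2 g) := by
    refine Finset.sum_congr rfl fun m _ => ?_
    rw [downPow_mul, Finset.smul_sum]
    refine Finset.sum_congr rfl fun p hp => ?_
    have hp' := Finset.HasAntidiagonal.mem_antidiagonal.1 hp
    have := Ring.choose_smul_choose w (n := m) (k := p.2) (by omega)
    rw [show m - p.2 = p.1 by omega] at this
    rw [binom_eq_choose, binom_eq_choose, binom_eq_choose, ← this, smul_comm, smul_assoc,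
      m.choose_symm_of_eq_add hp'.symm]
  rw [h1, sum_antidiagonal_trunc, Finset.sum_product_right]
  · refine Finset.sum_congr rfl fun q _ => ?_
    rw [phiTrunc, Finset.sum_mul, Finset.smul_sum]
    refine Finset.sum_congr rfl fun k _ => ?_
    rw [smul_mul_assoc, smul_smul]
  · rintro p (h | h)
    · rw [downPow_eq_zero_of_le hF h, zero_mul, smul_zero]
    · rw [downPow_eq_zero_of_le hg h, mul_zero, smul_zero]

theorem star_assoc_eigen {a z w : 𝕜} (f : Poly 𝕜 n) {g h : Poly 𝕜 n}
    (hg : eulerDer n a g = z • g) (hh : eulerDer n a h = w • h) :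
    star n a (star n a f g) h = star n a f (star n a g h) := by
  obtain ⟨N, hN⟩ := exists_downPow_eq_zero f
  obtain ⟨K, hK⟩ := exists_downPow_eq_zero g
  have hF := downPow_phiTrunc z hN le_rfl
  have hFg : downPow n (N + K) (phiTrunc z N f * g) = 0 := by
    rw [downPow_mul]
    refine Finset.sum_eq_zero fun p hp => ?_
    have hp' := Finset.HasAntidiagonal.mem_antidiagonal.1 hp
    rcases le_or_gt N p.1 with h | h
    · rw [downPow_eq_zero_of_le hF h, zero_mul, smul_zero]
    · rw [downPow_eq_zero_of_le hK (by omega), mul_zero, smul_zero]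
  rw [star_eigen hN hg, star_eigen hFg hh, phiTrunc_mul w hF hK, star_eigen hK hh,
    show phiTrunc w K g = ∑ q ∈ Finset.range K, binom w q • downPow n q g from rfl,
    Finset.sum_mul, Finset.sum_mul, star_sum]
  refine Finset.sum_congr rfl fun q _ => ?_
  rw [smul_mul_assoc, smul_mul_assoc, star_smul,
    star_eigen hN (eulerDer_mul (eulerDer_downPow hg q) hh), phiTrunc_comp _ _ hN, mul_assoc]
  congr 3
  ring

theorem star_assoc (a : 𝕜) (f g h : Poly 𝕜 n) :
    star n a (star n a f g) h = star n a f (star n a g h) := by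
  induction g using MvPolynomial.induction_on' with
  | monomial s c =>
    induction h using MvPolynomial.induction_on' with
    | monomial t d =>
      obtain ⟨z, hz⟩ := exists_eulerDer_monomial a s
      obtain ⟨w, hw⟩ := exists_eulerDer_monomial a t
      exact star_assoc_eigen f (hz c) (hw d)
    | add p q hp hq => rw [star_add, star_add, star_add, hp, hq]
  | add p q hp hq => rw [star_add, add_star, add_star, star_add, hp, hq]

end CharZero

theorem one_star (a : 𝕜) (f : Poly 𝕜 n) : star n a 1 f = f := by
  have h : downPow n 1 (1 : Poly 𝕜 n) = 0 := by simp [downPow_succ, downPow_zero]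
  rw [star_eq_sum a h]
  simp [downPow_zero, binomEuler]

theorem star_one (a : 𝕜) (f : Poly 𝕜 n) : star n a f 1 = f := by
  obtain ⟨N, hN⟩ := exists_downPow_eq_zero f
  have h1 : eulerDer n a (1 : Poly 𝕜 n) = (0 : 𝕜) • (1 : Poly 𝕜 n) := by simp
  have hN' := downPow_eq_zero_of_le hN (Nat.le_succ N)
  rw [star_eq_sum a hN', Finset.sum_range_succ', Finset.sum_eq_zero]
  · rw [binomEuler_apply h1]
    simp [downPow_zero, binom]
  · intro k _
    rw [binomEuler_apply h1]
    simp [binom]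

/-! ### The algebra `R(n,a)` -/

/-- The underlying space of the algebra `R(n,a)`, namely the polynomial ring `𝕜[X_0, …, X_n]`
as a vector space. -/
def R {𝕜 : Type*} [Field 𝕜] (n : ℕ) (_a : 𝕜) : Type _ := Poly 𝕜 n

namespace R

instance (a : 𝕜) : AddCommGroup (R n a) := inferInstanceAs (AddCommGroup (Poly 𝕜 n))

instance (a : 𝕜) : Module 𝕜 (R n a) := inferInstanceAs (Module 𝕜 (Poly 𝕜 n))

/-- The identity map from the polynomial ring to `R(n,a)`; it is linear, not multiplicative. -/
def of (a : 𝕜) : Poly 𝕜 n ≃ₗ[𝕜] R n a := LinearEquiv.refl 𝕜 (Poly 𝕜 n)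

variable [CharZero 𝕜]

/-- `R(n,a)` is the polynomial ring with the multiplication `∗_a`. -/
instance (a : 𝕜) : Ring (R n a) :=
  { (inferInstance : AddCommGroup (R n a)) with
    mul := fun f g => of a (star n a ((of a).symm f) ((of a).symm g))
    one := of a 1
    mul_assoc := star_assoc (n := n) a
    one_mul := one_star (n := n) a
    mul_one := star_one (n := n) a
    left_distrib := star_add (n := n) a
    right_distrib := add_star (n := n) a
    zero_mul := zero_star (n := n) a
    mul_zero := star_zero (n := n) a }

instance (a : 𝕜) : Algebra 𝕜 (R n a) :=
  Algebra.ofModule (fun c f g => smul_star (n := n) a c f g)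
    (fun c f g => star_smul (n := n) a c f g)

/-- The multiplication of `R(n,a)` is `∗_a`. -/
theorem of_star (a : 𝕜) (f g : Poly 𝕜 n) : of a (star n a f g) = of a f * of a g := rfl

theorem of_one (a : 𝕜) : of a (1 : Poly 𝕜 n) = 1 := rfl

/-- The generator `X_i` of `R(n,a)`. -/
def x (a : 𝕜) (i : Fin (n + 1)) : R n a := of a (MvPolynomial.X i)

/-- The component of `d`-degree `k` of `R(n,a)`, for the grading with `d(X_i) = 1`: the
homogeneous polynomials of degree `k`. -/
def component (a : 𝕜) (k : ℕ) : Submodule 𝕜 (R n a) :=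
  (MvPolynomial.homogeneousSubmodule (Fin (n + 1)) 𝕜 k).map (of a).toLinearMap

end R

/-! ### Groups of graded automorphisms -/

/-- The group `Aut_gr R(n,a)` of `d`-graded algebra automorphisms of `R(n,a)`. -/
def gradedAut [CharZero 𝕜] (n : ℕ) (a : 𝕜) : Subgroup (R n a ≃ₐ[𝕜] R n a) where
  carrier := {ψ | ∀ (k : ℕ) (f : R n a), ψ f ∈ R.component a k ↔ f ∈ R.component a k}
  one_mem' := fun _ _ => Iff.rfl
  mul_mem' := fun {ψ χ} hψ hχ k f => (hψ k (χ f)).trans (hχ k f)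
  inv_mem' := fun {ψ} hψ k f => by
    have h := hψ k (ψ⁻¹ f)
    rw [← AlgEquiv.mul_apply, mul_inv_cancel, AlgEquiv.one_apply] at h
    exact h.symm

variable (𝕜) in
/-- The group of `d`-graded algebra automorphisms of the commutative ring `𝕜[X_0, …, X_n]`. -/
def polyGradedAut (n : ℕ) : Subgroup (Poly 𝕜 n ≃ₐ[𝕜] Poly 𝕜 n) where
  carrier := {ψ | ∀ (k : ℕ) (f : Poly 𝕜 n), (ψ f).IsHomogeneous k ↔ f.IsHomogeneous k}
  one_mem' := fun _ _ => Iff.rfl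
  mul_mem' := fun {ψ χ} hψ hχ k f => (hψ k (χ f)).trans (hχ k f)
  inv_mem' := fun {ψ} hψ k f => by
    have h := hψ k (ψ⁻¹ f)
    rw [← AlgEquiv.mul_apply, mul_inv_cancel, AlgEquiv.one_apply] at h
    exact h.symm

/-- The group of Poisson automorphisms of `A(n,a)`: the algebra automorphisms of
`𝕜[X_0, …, X_n]` that preserve the bracket `{-,-}_a`. -/
def poissonAut (n : ℕ) (a : 𝕜) : Subgroup (Poly 𝕜 n ≃ₐ[𝕜] Poly 𝕜 n) where
  carrier := {ψ | ∀ f g : Poly 𝕜 n, ψ (bracket n a f g) = bracket n a (ψ f) (ψ g)}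
  one_mem' := fun _ _ => rfl
  mul_mem' := fun {ψ χ} hψ hχ f g => by
    simp only [AlgEquiv.mul_apply, hχ f g, hψ (χ f) (χ g)]
  inv_mem' := fun {ψ} hψ f g => by
    apply ψ.injective
    have hinv : ∀ p, ψ (ψ⁻¹ p) = p := fun p => by
      rw [← AlgEquiv.mul_apply, mul_inv_cancel, AlgEquiv.one_apply]
    rw [hψ, hinv, hinv, hinv]

/-- The group `PAut_gr A(n,a)` of `d`-graded Poisson automorphisms of `A(n,a)`. -/
def gradedPoissonAut (n : ℕ) (a : 𝕜) : Subgroup (Poly 𝕜 n ≃ₐ[𝕜] Poly 𝕜 n) :=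
  poissonAut n a ⊓ polyGradedAut 𝕜 n

end PymAlgebra

end

noncomputable section

namespace PymAlgebra

open MvPolynomial

section

variable {𝕜 : Type*} [Field 𝕜] {n : ℕ}

/-! ### Linear forms and their coordinates -/

variable (𝕜 n) in
/-- The space of linear forms, with basis `X_0, …, X_n`. -/
abbrev linearForms : Submodule 𝕜 (Poly 𝕜 n) := homogeneousSubmodule (Fin (n + 1)) 𝕜 1

variable (𝕜 n) in
/-- The variable `X_i`, indexed by natural numbers; it is `0` for `n < i`. -/
def var (i : ℕ) : Poly 𝕜 n := if h : i < n + 1 then X ⟨i, h⟩ else 0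

variable (𝕜 n) in
/-- The derivative with respect to `X_i`, indexed by natural numbers; it is `0` for `n < i`. -/
def varDer (i : ℕ) : Derivation 𝕜 (Poly 𝕜 n) (Poly 𝕜 n) :=
  if h : i < n + 1 then pderiv ⟨i, h⟩ else 0

/-- The coefficient of `X_i` in the linear part of a polynomial. -/
def coord (i : ℕ) : Poly 𝕜 n →ₗ[𝕜] 𝕜 :=
  lcoeff 𝕜 0 ∘ₗ (varDer 𝕜 n i : Poly 𝕜 n →ₗ[𝕜] Poly 𝕜 n)

/-- The mixed second partial derivative at the origin. -/
def coord₂ (i j : ℕ) : Poly 𝕜 n →ₗ[𝕜] 𝕜 :=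
  coord i ∘ₗ (varDer 𝕜 n j : Poly 𝕜 n →ₗ[𝕜] Poly 𝕜 n)

theorem X_eq_var (i : Fin (n + 1)) : (X i : Poly 𝕜 n) = var 𝕜 n i := by
  rw [var, dif_pos i.2]

theorem var_mem (i : ℕ) : var 𝕜 n i ∈ linearForms 𝕜 n := by
  rw [var]
  split_ifs
  · exact isHomogeneous_X _ _
  · exact zero_mem _

theorem var_eq_zero {i : ℕ} (h : n < i) : var 𝕜 n i = 0 := by
  rw [var, dif_neg (by omega)]

theorem linearForms_eq_span : linearForms 𝕜 n = Submodule.span 𝕜 (Set.range (var 𝕜 n)) := by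
  refine le_antisymm ?_ (Submodule.span_le.2 ?_)
  · rw [linearForms, homogeneousSubmodule_one_eq_span_X]
    refine Submodule.span_mono ?_
    rintro _ ⟨i, rfl⟩
    exact ⟨i, (X_eq_var i).symm⟩
  · rintro _ ⟨i, rfl⟩
    exact var_mem i

/-- Two linear maps that agree on the variables agree on the linear forms. -/
theorem eqOn_linearForms {M : Type*} [AddCommGroup M] [Module 𝕜 M] {A B : Poly 𝕜 n →ₗ[𝕜] M}
    (h : ∀ i ≤ n, A (var 𝕜 n i) = B (var 𝕜 n i)) {p : Poly 𝕜 n} (hp : p ∈ linearForms 𝕜 n) :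
    A p = B p := by
  rw [linearForms_eq_span] at hp
  refine LinearMap.eqOn_span (f := A) (g := B) ?_ hp
  rintro _ ⟨i, rfl⟩
  rcases le_or_gt i n with hi | hi
  · exact h i hi
  · rw [var_eq_zero hi, map_zero, map_zero]

theorem varDer_var {i j : ℕ} (hj : j ≤ n) :
    varDer 𝕜 n i (var 𝕜 n j) = if i = j then 1 else 0 := by
  rw [varDer, var, dif_pos (show j < n + 1 by omega)]
  split_ifs with h1 h2 h2
  · subst h2; rw [pderiv_X_self]
  · rw [pderiv_X_of_ne]
    intro h
    exact h2 (congrArg Fin.val h).symm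
  · omega
  · rfl

theorem coord_apply (i : ℕ) (p : Poly 𝕜 n) : coord i p = coeff 0 (varDer 𝕜 n i p) := rfl

theorem coord_var {i j : ℕ} (hj : j ≤ n) :
    coord i (var 𝕜 n j) = if i = j then (1 : 𝕜) else 0 := by
  rw [coord_apply, varDer_var hj]
  split_ifs <;> simp

theorem coord_eq_zero {i : ℕ} (h : n < i) (p : Poly 𝕜 n) : coord i p = 0 := by
  rw [coord_apply, varDer, dif_neg (by omega)]
  simp

theorem varDer_eq_C (i : ℕ) {p : Poly 𝕜 n} (hp : p ∈ linearForms 𝕜 n) :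
    varDer 𝕜 n i p = C (coord i p) := by
  refine eqOn_linearForms (A := (varDer 𝕜 n i : Poly 𝕜 n →ₗ[𝕜] Poly 𝕜 n))
    (B := (Algebra.linearMap 𝕜 (Poly 𝕜 n)) ∘ₗ coord i) (fun j hj => ?_) hp
  simp only [Derivation.coeFn_coe, LinearMap.comp_apply, coord_var hj, varDer_var hj]
  split_ifs <;> simp

theorem eq_sum_coord {p : Poly 𝕜 n} (hp : p ∈ linearForms 𝕜 n) :
    p = ∑ i ∈ Finset.range (n + 1), coord i p • var 𝕜 n i := by
  have := eqOn_linearForms (A := LinearMap.id)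
    (B := ∑ i ∈ Finset.range (n + 1), (coord i).smulRight (var 𝕜 n i)) (fun j hj => ?_) hp
  · simpa using this
  · simp only [LinearMap.id_apply, LinearMap.sum_apply, LinearMap.smulRight_apply, coord_var hj]
    simp [Finset.sum_ite_eq', Nat.lt_succ_iff.2 hj]

theorem linearForm_ext {p q : Poly 𝕜 n} (hp : p ∈ linearForms 𝕜 n) (hq : q ∈ linearForms 𝕜 n)
    (h : ∀ i ≤ n, (coord i p : 𝕜) = coord i q) : p = q := by
  rw [eq_sum_coord hp, eq_sum_coord hq]
  refine Finset.sum_congr rfl fun i hi => ?_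
  rw [h i (by simpa [Nat.lt_succ_iff] using hi)]

theorem eq_smul_var {p : Poly 𝕜 n} {k : ℕ} (hp : p ∈ linearForms 𝕜 n)
    (h : ∀ i, i ≠ k → (coord i p : 𝕜) = 0) : p = (coord k p : 𝕜) • var 𝕜 n k := by
  rcases le_or_gt k n with hk | hk
  · refine linearForm_ext hp (Submodule.smul_mem _ _ (var_mem k)) fun i _ => ?_
    rw [map_smul, coord_var hk]
    split_ifs with hik
    · simp [hik]
    · simp [h i hik]
  · rw [var_eq_zero hk, smul_zero]
    refine linearForm_ext hp (zero_mem _) fun i hi => ?_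
    rw [h i (by omega), map_zero]

theorem eq_smul_var_add {p : Poly 𝕜 n} (hn : 1 ≤ n) (hp : p ∈ linearForms 𝕜 n)
    (h : ∀ i, 2 ≤ i → (coord i p : 𝕜) = 0) :
    p = (coord 0 p : 𝕜) • var 𝕜 n 0 + (coord 1 p : 𝕜) • var 𝕜 n 1 := by
  refine linearForm_ext hp (add_mem (Submodule.smul_mem _ _ (var_mem 0))
    (Submodule.smul_mem _ _ (var_mem 1))) fun i _ => ?_
  rw [map_add, map_smul, map_smul, coord_var (by omega), coord_var hn]
  obtain rfl | rfl | hi : i = 0 ∨ i = 1 ∨ 2 ≤ i := by omega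
  · simp
  · simp
  · simp [h i hi, show i ≠ 0 by omega, show i ≠ 1 by omega]

theorem exists_top_coord {p : Poly 𝕜 n} (hp : p ∈ linearForms 𝕜 n) (h : p ≠ 0) :
    ∃ s ≤ n, (coord s p : 𝕜) ≠ 0 ∧ ∀ i, s < i → (coord i p : 𝕜) = 0 := by
  classical
  obtain ⟨k, hk, hk'⟩ : ∃ k ≤ n, (coord k p : 𝕜) ≠ 0 := by
    by_contra! hc
    exact h (linearForm_ext hp (zero_mem _) fun i hi => by rw [hc i hi, map_zero])
  refine ⟨Nat.findGreatest (fun i => (coord i p : 𝕜) ≠ 0) n, Nat.findGreatest_le n,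
    Nat.findGreatest_spec (P := fun i => (coord i p : 𝕜) ≠ 0) hk hk', fun i hi => ?_⟩
  rcases le_or_gt i n with hin | hin
  · by_contra hc
    exact Nat.findGreatest_is_greatest hi hin hc
  · exact coord_eq_zero hin p

theorem coord₂_mul (i j : ℕ) {p q : Poly 𝕜 n} (hp : p ∈ linearForms 𝕜 n)
    (hq : q ∈ linearForms 𝕜 n) :
    coord₂ i j (p * q) = (coord i p * coord j q + coord j p * coord i q : 𝕜) := by
  rw [coord₂, LinearMap.comp_apply, Derivation.coeFn_coe, Derivation.leibniz, varDer_eq_C j hp,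
    varDer_eq_C j hq, coord_apply, map_add]
  simp only [smul_eq_mul, mul_comm p, mul_comm q, ← smul_eq_C_mul, Derivation.map_smul,
    varDer_eq_C i hp, varDer_eq_C i hq]
  simp
  ring

/-- In degree two, `X_1 p = X_0 q` only has the trivial solutions. -/
theorem coord_of_var_mul_eq [CharZero 𝕜] (hn : 1 ≤ n) {p q : Poly 𝕜 n} (hp : p ∈ linearForms 𝕜 n)
    (hq : q ∈ linearForms 𝕜 n) (h : var 𝕜 n 1 * p = var 𝕜 n 0 * q) :
    (∀ i, i ≠ 0 → (coord i p : 𝕜) = 0) ∧ (∀ i, i ≠ 1 → (coord i q : 𝕜) = 0) ∧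
      (coord 0 p : 𝕜) = coord 1 q := by
  have key (i j : ℕ) := congrArg (coord₂ i j) h
  simp only [coord₂_mul _ _ (var_mem _) hp, coord₂_mul _ _ (var_mem _) hq, coord_var hn,
    coord_var (Nat.zero_le n)] at key
  refine ⟨fun i hi => ?_, fun i hi => ?_, ?_⟩
  · have := key 1 i
    by_cases h1 : i = 1
    · subst h1
      simpa using this
    · simpa [hi, h1] using this
  · have := key 0 i
    by_cases h0 : i = 0
    · subst h0
      simpa using this.symm
    · simpa [hi, h0] using this.symm
  · simpa using key 0 1

theorem downDer_var_zero : downDer 𝕜 n (var 𝕜 n 0) = 0 := by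
  simp [var, downDer]

theorem downDer_var_succ {i : ℕ} (h : i + 1 ≤ n) :
    downDer 𝕜 n (var 𝕜 n (i + 1)) = var 𝕜 n i := by
  have h1 : i < n := by omega
  have : (⟨i + 1, by omega⟩ : Fin (n + 1)) = Fin.succ ⟨i, h1⟩ := rfl
  rw [var, dif_pos (by omega), var, dif_pos (by omega), this, downDer, mkDerivation_X,
    Fin.cases_succ]
  rfl

theorem eulerDer_var (a : 𝕜) (i : ℕ) : eulerDer n a (var 𝕜 n i) = (a + i) • var 𝕜 n i := by
  rw [var]
  split_ifs
  · exact mkDerivation_X _ _ _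
  · simp

theorem coord_downDer (i : ℕ) {p : Poly 𝕜 n} (hp : p ∈ linearForms 𝕜 n) :
    coord i (downDer 𝕜 n p) = (coord (i + 1) p : 𝕜) := by
  refine eqOn_linearForms (A := coord i ∘ₗ (downDer 𝕜 n : Poly 𝕜 n →ₗ[𝕜] Poly 𝕜 n))
    (B := coord (i + 1)) (fun j hj => ?_) hp
  rw [LinearMap.comp_apply, Derivation.coeFn_coe, coord_var hj]
  cases j with
  | zero => rw [downDer_var_zero]; simp
  | succ j => rw [downDer_var_succ hj, coord_var (by omega)]; simp

theorem coord_eulerDer (a : 𝕜) (i : ℕ) {p : Poly 𝕜 n} (hp : p ∈ linearForms 𝕜 n) :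
    coord i (eulerDer n a p) = (a + i) * coord i p := by
  refine eqOn_linearForms (A := coord i ∘ₗ (eulerDer n a : Poly 𝕜 n →ₗ[𝕜] Poly 𝕜 n))
    (B := (a + i : 𝕜) • coord i) (fun j hj => ?_) hp
  simp only [LinearMap.comp_apply, Derivation.coeFn_coe, LinearMap.smul_apply, coord_var hj,
    eulerDer_var, map_smul, smul_eq_mul]
  split_ifs with h
  · rw [h]
  · simp

theorem map_mem_linearForms {A : Poly 𝕜 n →ₗ[𝕜] Poly 𝕜 n}
    (h : ∀ i ≤ n, A (var 𝕜 n i) ∈ linearForms 𝕜 n) {p : Poly 𝕜 n} (hp : p ∈ linearForms 𝕜 n) :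
    A p ∈ linearForms 𝕜 n := by
  rw [eq_sum_coord hp, map_sum]
  refine Submodule.sum_mem _ fun i hi => ?_
  rw [map_smul]
  exact Submodule.smul_mem _ _ (h i (by simpa [Nat.lt_succ_iff] using hi))

theorem downDer_mem {p : Poly 𝕜 n} (hp : p ∈ linearForms 𝕜 n) :
    downDer 𝕜 n p ∈ linearForms 𝕜 n := by
  refine map_mem_linearForms (A := (downDer 𝕜 n : Poly 𝕜 n →ₗ[𝕜] Poly 𝕜 n)) (fun i hi => ?_) hp
  rw [Derivation.coeFn_coe]
  cases i with
  | zero => rw [downDer_var_zero]; exact zero_mem _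
  | succ i => rw [downDer_var_succ hi]; exact var_mem i

theorem eulerDer_mem (a : 𝕜) {p : Poly 𝕜 n} (hp : p ∈ linearForms 𝕜 n) :
    eulerDer n a p ∈ linearForms 𝕜 n := by
  refine map_mem_linearForms (A := (eulerDer n a : Poly 𝕜 n →ₗ[𝕜] Poly 𝕜 n)) (fun i hi => ?_) hp
  rw [Derivation.coeFn_coe, eulerDer_var]
  exact Submodule.smul_mem _ _ (var_mem i)

theorem downPow_mem (k : ℕ) {p : Poly 𝕜 n} (hp : p ∈ linearForms 𝕜 n) :
    downPow n k p ∈ linearForms 𝕜 n := by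
  induction k with
  | zero => exact hp
  | succ k ih => rw [downPow_succ]; exact downDer_mem ih

theorem coord_downPow (k i : ℕ) {p : Poly 𝕜 n} (hp : p ∈ linearForms 𝕜 n) :
    coord i (downPow n k p) = (coord (i + k) p : 𝕜) := by
  induction k generalizing i with
  | zero => rfl
  | succ k ih =>
    rw [downPow_succ, coord_downDer i (downPow_mem k hp), ih, Nat.add_right_comm, add_assoc]

theorem downPow_linearForm {p : Poly 𝕜 n} (hp : p ∈ linearForms 𝕜 n) :
    downPow n (n + 1) p = 0 :=
  linearForm_ext (downPow_mem _ hp) (zero_mem _) fun i _ => by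
    rw [coord_downPow _ _ hp, coord_eq_zero (by omega), map_zero]

theorem binomEuler_var (a : 𝕜) (k i : ℕ) :
    binomEuler n a k (var 𝕜 n i) = binom (a + i) k • var 𝕜 n i :=
  binomEuler_apply (eulerDer_var a i) k

theorem binomEuler_mem (a : 𝕜) (k : ℕ) {p : Poly 𝕜 n} (hp : p ∈ linearForms 𝕜 n) :
    binomEuler n a k p ∈ linearForms 𝕜 n := by
  refine map_mem_linearForms (fun i hi => ?_) hp
  rw [binomEuler_var]
  exact Submodule.smul_mem _ _ (var_mem i)

theorem coord_binomEuler (a : 𝕜) (k i : ℕ) {p : Poly 𝕜 n} (hp : p ∈ linearForms 𝕜 n) :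
    coord i (binomEuler n a k p) = binom (a + i) k * coord i p := by
  refine eqOn_linearForms (A := coord i ∘ₗ binomEuler n a k)
    (B := binom (a + i) k • coord i) (fun j hj => ?_) hp
  simp only [LinearMap.comp_apply, LinearMap.smul_apply, coord_var hj,
    binomEuler_var, map_smul, smul_eq_mul]
  split_ifs with h
  · rw [h]
  · simp

theorem binom_zero (z : 𝕜) : binom z 0 = 1 := by simp [binom]

theorem binom_one (z : 𝕜) : binom z 1 = z := by simp [binom]

theorem binomEuler_zero (a : 𝕜) (f : Poly 𝕜 n) : binomEuler n a 0 f = f := by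
  simp [binomEuler]

theorem binomEuler_one (a : 𝕜) (f : Poly 𝕜 n) : binomEuler n a 1 f = eulerDer n a f := by
  simp [binomEuler]

theorem downPow_one (f : Poly 𝕜 n) : downPow n 1 f = downDer 𝕜 n f := by
  rw [downPow_succ, downPow_zero]

theorem var_zero_star (a : 𝕜) (f : Poly 𝕜 n) : star n a (var 𝕜 n 0) f = var 𝕜 n 0 * f := by
  rw [star_eq_sum a (N := 1) (by rw [downPow_one, downDer_var_zero])]
  simp [downPow_zero, binomEuler_zero]

theorem var_one_star (hn : 1 ≤ n) (a : 𝕜) (f : Poly 𝕜 n) :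
    star n a (var 𝕜 n 1) f = var 𝕜 n 1 * f + var 𝕜 n 0 * eulerDer n a f := by
  have h1 : downPow n 1 (var 𝕜 n 1) = var 𝕜 n 0 := by rw [downPow_one, downDer_var_succ hn]
  rw [star_eq_sum a (N := 2) (by rw [downPow_succ, h1, downDer_var_zero])]
  simp [Finset.sum_range_succ, downPow_zero, h1, binomEuler_zero, binomEuler_one]

/-! ### Power series in `Δ` -/

/-- The operator `∑_k c_k Δ^k` for a power series `∑_k c_k t^k`. -/
def series (s : PowerSeries 𝕜) : Poly 𝕜 n →ₗ[𝕜] Poly 𝕜 n where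
  toFun f := ∑ᶠ k : ℕ, PowerSeries.coeff k s • downPow n k f
  map_add' f g := by
    have hfin (f : Poly 𝕜 n) :
        (Function.support fun k => PowerSeries.coeff k s • downPow n k f).Finite := by
      obtain ⟨N, hN⟩ := exists_downPow_eq_zero f
      refine (Set.finite_lt_nat N).subset fun k hk => ?_
      by_contra hk'
      exact hk (by
        simp only [Set.mem_ofPred_eq, not_lt] at hk'
        simp only [downPow_eq_zero_of_le hN hk', smul_zero])
    simp only [map_add, smul_add]
    exact finsum_add_distrib (hfin f) (hfin g)
  map_smul' c f := by
    simp only [map_smul, RingHom.id_apply, smul_finsum, smul_comm c]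

theorem series_eq_sum (s : PowerSeries 𝕜) {f : Poly 𝕜 n} {N : ℕ} (h : downPow n N f = 0) :
    series s f = ∑ k ∈ Finset.range N, PowerSeries.coeff k s • downPow n k f := by
  refine finsum_eq_sum_of_support_subset _ fun k hk => ?_
  by_contra hk'
  refine hk ?_
  simp only [Finset.coe_range, Set.mem_Iio, not_lt] at hk'
  simp only [downPow_eq_zero_of_le h hk', smul_zero]

theorem downDer_series (s : PowerSeries 𝕜) (f : Poly 𝕜 n) :
    downDer 𝕜 n (series s f) = series s (downDer 𝕜 n f) := by
  obtain ⟨N, hN⟩ := exists_downPow_eq_zero f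
  have hN' : downPow n N (downDer 𝕜 n f) = 0 := by
    rw [← downPow_one, ← downPow_add]
    exact downPow_eq_zero_of_le hN (by omega)
  rw [series_eq_sum s hN, series_eq_sum s hN', map_sum]
  refine Finset.sum_congr rfl fun k _ => ?_
  rw [Derivation.map_smul, ← downPow_succ, ← downPow_one, ← downPow_add]

theorem downPow_series (s : PowerSeries 𝕜) (k : ℕ) (f : Poly 𝕜 n) :
    downPow n k (series s f) = series s (downPow n k f) := by
  induction k with
  | zero => rfl
  | succ k ih => rw [downPow_succ, downPow_succ, ih, downDer_series]

theorem series_mul (s t : PowerSeries 𝕜) (f : Poly 𝕜 n) :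
    series (s * t) f = series s (series t f) := by
  obtain ⟨N, hN⟩ := exists_downPow_eq_zero f
  have hN' : downPow n N (series t f) = 0 := by rw [downPow_series, hN, map_zero]
  rw [series_eq_sum s hN', series_eq_sum t hN,
    series_eq_sum _ (downPow_eq_zero_of_le hN (Nat.le_add_right N N))]
  have h1 : ∑ m ∈ Finset.range (N + N), PowerSeries.coeff m (s * t) • downPow n m f =
      ∑ m ∈ Finset.range (N + N), ∑ p ∈ Finset.HasAntidiagonal.antidiagonal m,
        (PowerSeries.coeff p.1 s * PowerSeries.coeff p.2 t) • downPow n (p.1 + p.2) f := by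
    refine Finset.sum_congr rfl fun m _ => ?_
    rw [PowerSeries.coeff_mul, Finset.sum_smul]
    refine Finset.sum_congr rfl fun p hp => ?_
    rw [Finset.HasAntidiagonal.mem_antidiagonal.1 hp]
  rw [h1, sum_antidiagonal_trunc, Finset.sum_product]
  · refine Finset.sum_congr rfl fun k _ => ?_
    rw [map_sum, Finset.smul_sum]
    refine Finset.sum_congr rfl fun j _ => ?_
    rw [map_smul, smul_smul, downPow_add]
  · rintro p (h | h) <;> rw [downPow_eq_zero_of_le hN (by omega), smul_zero]

theorem series_one (f : Poly 𝕜 n) : series 1 f = f := by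
  obtain ⟨N, hN⟩ := exists_downPow_eq_zero f
  rw [series_eq_sum 1 (downPow_eq_zero_of_le hN (Nat.le_succ N)), Finset.sum_eq_single 0]
  · simp [downPow_zero]
  · intro k _ hk
    simp [PowerSeries.coeff_one, hk]
  · simp

theorem series_linearForm (s : PowerSeries 𝕜) {p : Poly 𝕜 n} (hp : p ∈ linearForms 𝕜 n) :
    series s p = ∑ k ∈ Finset.range (n + 1), PowerSeries.coeff k s • downPow n k p :=
  series_eq_sum s (downPow_linearForm hp)

theorem series_mem (s : PowerSeries 𝕜) {p : Poly 𝕜 n} (hp : p ∈ linearForms 𝕜 n) :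
    series s p ∈ linearForms 𝕜 n := by
  rw [series_linearForm s hp]
  exact Submodule.sum_mem _ fun k _ => Submodule.smul_mem _ _ (downPow_mem k hp)

theorem series_var_zero (s : PowerSeries 𝕜) :
    series s (var 𝕜 n 0) = PowerSeries.coeff 0 s • var 𝕜 n 0 := by
  rw [series_eq_sum s (N := 1) (by rw [downPow_one, downDer_var_zero])]
  simp [downPow_zero]

theorem series_var_one (hn : 1 ≤ n) (s : PowerSeries 𝕜) :
    series s (var 𝕜 n 1) =
      PowerSeries.coeff 0 s • var 𝕜 n 1 + PowerSeries.coeff 1 s • var 𝕜 n 0 := by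
  have h1 : downPow n 1 (var 𝕜 n 1) = var 𝕜 n 0 := by rw [downPow_one, downDer_var_succ hn]
  rw [series_eq_sum s (N := 2) (by rw [downPow_succ, h1, downDer_var_zero])]
  simp [Finset.sum_range_succ, downPow_zero, h1]

theorem downPow_var {j k : ℕ} (hj : j ≤ n) :
    downPow n k (var 𝕜 n j) = if k ≤ j then var 𝕜 n (j - k) else 0 := by
  refine linearForm_ext (downPow_mem _ (var_mem j)) ?_ fun i _ => ?_
  · split_ifs
    · exact var_mem _
    · exact zero_mem _
  · rw [coord_downPow _ _ (var_mem j), coord_var hj]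
    split_ifs with h1 h2 h2
    · rw [coord_var (by omega), if_pos (by omega)]
    · omega
    · rw [coord_var (by omega), if_neg (by omega)]
    · rw [map_zero]

/-- The two leading coordinates of a power series in `Δ` applied to a linear form. -/
theorem coord_series_top (s : PowerSeries 𝕜) {p : Poly 𝕜 n} (hp : p ∈ linearForms 𝕜 n) {r : ℕ}
    (h : ∀ i, r < i → (coord i p : 𝕜) = 0) :
    coord r (series s p) = PowerSeries.coeff 0 s * coord r p := by
  rw [series_linearForm s hp, map_sum, Finset.sum_eq_single 0]
  · rw [map_smul, smul_eq_mul, downPow_zero]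
  · intro k _ hk
    rw [map_smul, coord_downPow _ _ hp, h _ (by omega), smul_zero]
  · simp

theorem coord_series_pred (hn : 1 ≤ n) (s : PowerSeries 𝕜) {p : Poly 𝕜 n}
    (hp : p ∈ linearForms 𝕜 n) {r : ℕ} (h : ∀ i, r + 1 < i → (coord i p : 𝕜) = 0) :
    coord r (series s p) =
      PowerSeries.coeff 0 s * coord r p + PowerSeries.coeff 1 s * coord (r + 1) p := by
  have h0 : ∀ k ∈ Finset.range (n + 1), k ∉ Finset.range 2 →
      coord r (PowerSeries.coeff k s • downPow n k p) = (0 : 𝕜) := by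
    intro k _ hk
    rw [map_smul, coord_downPow _ _ hp, h _ (by simp at hk; omega), smul_zero]
  rw [series_linearForm s hp, map_sum,
    ← Finset.sum_subset (Finset.range_mono (show 2 ≤ n + 1 by omega)) h0]
  simp [Finset.sum_range_succ, coord_downPow _ _ hp]

end

section

variable {𝕜 : Type*} [Field 𝕜] {n : ℕ}

/-! ### Rigidity of linear maps on linear forms -/

theorem var_ne_zero {i : ℕ} (hi : i ≤ n) : var 𝕜 n i ≠ 0 := by
  intro h
  have := congrArg (coord i) h
  simp [coord_var hi] at this

theorem coord₂_mul_ne_zero [CharZero 𝕜] {p q : Poly 𝕜 n} (hp : p ∈ linearForms 𝕜 n)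
    (hq : q ∈ linearForms 𝕜 n) {s r : ℕ} (hs : (coord s p : 𝕜) ≠ 0)
    (hs' : ∀ i, s < i → (coord i p : 𝕜) = 0) (hr : (coord r q : 𝕜) ≠ 0)
    (hr' : ∀ i, r < i → (coord i q : 𝕜) = 0) : (coord₂ s r (p * q) : 𝕜) ≠ 0 := by
  rw [coord₂_mul _ _ hp hq]
  rcases lt_trichotomy s r with h | rfl | h
  · rw [hs' r h]
    simpa using ⟨hs, hr⟩
  · rw [← two_mul]
    simpa using ⟨hs, hr⟩
  · rw [hr' s h]
    simpa using ⟨hs, hr⟩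

theorem coord₂_var_mul {i j k : ℕ} (hk : k ≤ n) (hi : i ≠ k) (hj : j ≠ k) {q : Poly 𝕜 n}
    (hq : q ∈ linearForms 𝕜 n) : (coord₂ i j (var 𝕜 n k * q) : 𝕜) = 0 := by
  rw [coord₂_mul _ _ (var_mem k) hq, coord_var hk, coord_var hk, if_neg hi, if_neg hj]
  ring

/-- A linear map fixing `X_0` and commuting with `Δ` and `Γ_a` fixes all linear forms. -/
theorem eq_self_of_commute [CharZero 𝕜] (a : 𝕜) {T : Poly 𝕜 n →ₗ[𝕜] Poly 𝕜 n}
    (hT : ∀ p ∈ linearForms 𝕜 n, T p ∈ linearForms 𝕜 n) (h0 : T (var 𝕜 n 0) = var 𝕜 n 0)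
    (hD : ∀ p ∈ linearForms 𝕜 n, T (downDer 𝕜 n p) = downDer 𝕜 n (T p))
    (hE : ∀ p ∈ linearForms 𝕜 n, T (eulerDer n a p) = eulerDer n a (T p)) {p : Poly 𝕜 n}
    (hp : p ∈ linearForms 𝕜 n) : T p = p := by
  refine eqOn_linearForms (A := T) (B := LinearMap.id) (fun j hj => ?_) hp
  rw [LinearMap.id_apply]
  induction j with
  | zero => exact h0
  | succ j ih =>
    have hm := hT _ (var_mem (𝕜 := 𝕜) (n := n) (j + 1))
    have hdiag (i : ℕ) (hi : i ≠ j + 1) : (coord i (T (var 𝕜 n (j + 1))) : 𝕜) = 0 := by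
      have h1 := congrArg (coord i) (hE _ (var_mem (j + 1)))
      rw [eulerDer_var, map_smul, map_smul, coord_eulerDer a i hm, smul_eq_mul, ← sub_eq_zero,
        ← sub_mul] at h1
      refine (mul_eq_zero.1 h1).resolve_left fun h2 => hi ?_
      have h3 : ((j + 1 : ℕ) : 𝕜) = i := by linear_combination h2
      exact_mod_cast h3.symm
    have h1 := congrArg (coord j) (hD _ (var_mem (j + 1)))
    rw [downDer_var_succ hj, ih (by omega), coord_downDer _ hm, coord_var (by omega)] at h1
    rw [eq_smul_var hm hdiag, ← h1]
    simp

/-- The analogue of `eq_self_of_commute` when `a = 0`. -/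
theorem eq_self_of_commute_mod [CharZero 𝕜] (hn : 2 ≤ n) (ε μ : 𝕜) {T : Poly 𝕜 n →ₗ[𝕜] Poly 𝕜 n}
    (hT : ∀ p ∈ linearForms 𝕜 n, T p ∈ linearForms 𝕜 n) (hμ : μ ≠ 0)
    (h0 : T (var 𝕜 n 0) = var 𝕜 n 0) (h1 : T (var 𝕜 n 1) = μ • var 𝕜 n 1)
    (h : ∀ p ∈ linearForms 𝕜 n,
      var 𝕜 n 1 * (μ • (downDer 𝕜 n (T p) - T (downDer 𝕜 n p))) =
        var 𝕜 n 0 * (μ • eulerDer n 0 (T (p + ε • downDer 𝕜 n p)) -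
          T (eulerDer n 0 (p + ε • downDer 𝕜 n p)))) {p : Poly 𝕜 n}
    (hp : p ∈ linearForms 𝕜 n) : T p = p := by
  have hn1 : 1 ≤ n := by omega
  have hmem (p : Poly 𝕜 n) (hp : p ∈ linearForms 𝕜 n) : p + ε • downDer 𝕜 n p ∈ linearForms 𝕜 n :=
    add_mem hp (Submodule.smul_mem _ _ (downDer_mem hp))
  have key (p : Poly 𝕜 n) (hp : p ∈ linearForms 𝕜 n) := coord_of_var_mul_eq hn1
    (Submodule.smul_mem _ μ (sub_mem (downDer_mem (hT _ hp)) (hT _ (downDer_mem hp))))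
    (sub_mem (Submodule.smul_mem _ μ (eulerDer_mem 0 (hT _ (hmem p hp))))
      (hT _ (eulerDer_mem 0 (hmem p hp)))) (h p hp)
  set t : ℕ → ℕ → 𝕜 := fun i j => coord i (T (var 𝕜 n j)) with ht
  set M : ℕ → ℕ → 𝕜 := fun i j => (μ * i - j) * t i j with hM
  have hv (j : ℕ) : T (var 𝕜 n j) ∈ linearForms 𝕜 n := hT _ (var_mem j)
  have hME (i j : ℕ) : coord i (μ • eulerDer n 0 (T (var 𝕜 n j)) - T (eulerDer n 0 (var 𝕜 n j))) =
      M i j := by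
    rw [map_sub, map_smul, coord_eulerDer _ _ (hv j), eulerDer_var, map_smul, map_smul]
    simp only [hM, ht, smul_eq_mul]
    ring
  have hM0 (i : ℕ) (hi : i ≠ 1) : M i 0 = 0 := by
    have := (key _ (var_mem 0)).2.1 i hi
    rwa [downDer_var_zero, smul_zero, add_zero, hME] at this
  have hq (i j : ℕ) (hj : j + 1 ≤ n) : coord i (μ • eulerDer n 0 (T (var 𝕜 n (j + 1) +
      ε • downDer 𝕜 n (var 𝕜 n (j + 1)))) - T (eulerDer n 0 (var 𝕜 n (j + 1) +
      ε • downDer 𝕜 n (var 𝕜 n (j + 1))))) = M i (j + 1) + ε * M i j := by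
    rw [downDer_var_succ hj, ← hME, ← hME, ← smul_eq_mul, ← (coord i).map_smul, ← (coord i).map_add]
    congr 1
    simp only [map_add, map_smul, Derivation.map_smul, smul_add, smul_sub, smul_comm ε μ]
    abel
  have hMsucc (i j : ℕ) (hi : i ≠ 1) (hj : j + 1 ≤ n) : M i (j + 1) + ε * M i j = 0 := by
    rw [← hq i j hj]
    exact (key _ (var_mem (j + 1))).2.1 i hi
  have hMz (i j : ℕ) (hi : i ≠ 1) (hj : j ≤ n) : M i j = 0 := by
    induction j with
    | zero => exact hM0 i hi
    | succ j ih =>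
      have := hMsucc i j hi hj
      rwa [ih (by omega), mul_zero, add_zero] at this
  have hp' (i j : ℕ) (hj : j + 1 ≤ n) : coord i (μ • (downDer 𝕜 n (T (var 𝕜 n (j + 1))) -
      T (downDer 𝕜 n (var 𝕜 n (j + 1))))) = μ * (t (i + 1) (j + 1) - t i j) := by
    rw [downDer_var_succ hj, map_smul, map_sub, coord_downDer _ (hv _), smul_eq_mul]
  have hshift (i j : ℕ) (hi : i ≠ 0) (hj : j + 1 ≤ n) : t (i + 1) (j + 1) = t i j := by
    have := (key _ (var_mem (j + 1))).1 i hi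
    rw [hp' i j hj] at this
    exact sub_eq_zero.1 ((mul_eq_zero.1 this).resolve_left hμ)
  have ht1 (i : ℕ) : t i 1 = if i = 1 then μ else 0 := by
    simp only [ht, h1, map_smul, coord_var hn1, smul_eq_mul]
    split_ifs <;> simp
  have hμ1 : μ = 1 := by
    have h2 := hMz 2 2 (by omega) hn
    simp only [hM, hshift 1 1 (by omega) hn, ht1, if_true] at h2
    have h3 := (mul_eq_zero.1 h2).resolve_right hμ
    push_cast at h3
    have h4 : (2 : 𝕜) * (μ - 1) = 0 := by linear_combination h3
    exact sub_eq_zero.1 ((mul_eq_zero.1 h4).resolve_left two_ne_zero)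
  subst hμ1
  have hoff (i j : ℕ) (hi : i ≠ 1) (hij : i ≠ j) (hj : j ≤ n) : t i j = 0 := by
    have h2 := hMz i j hi hj
    refine (mul_eq_zero.1 h2).resolve_left fun h3 => hij ?_
    have h4 : (i : 𝕜) = j := by linear_combination h3
    exact_mod_cast h4
  have hdiag (j : ℕ) (hj : j + 1 ≤ n) : t (j + 1) (j + 1) = 1 := by
    induction j with
    | zero => simp [ht1]
    | succ j ih => rw [hshift _ _ (by omega) hj, ih (by omega)]
  have hone (j : ℕ) (hj : 2 ≤ j) (hjn : j ≤ n) : t 1 j = 0 := by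
    rcases Nat.lt_or_ge j n with hlt | hge
    · rw [← hshift 1 j (by omega) hlt]
      exact hoff _ _ (by omega) (by omega) hlt
    · obtain ⟨j, rfl⟩ := Nat.exists_eq_add_of_le' hj
      have h2 := (key _ (var_mem (j + 1 + 1))).2.2
      have h3 : M 1 (j + 1) = 0 := by
        rcases Nat.eq_zero_or_pos j with rfl | hjpos
        · simp [hM]
        · simp only [hM]
          rw [← hshift 1 (j + 1) (by omega) hjn, hoff (1 + 1) _ (by omega) (by omega) hjn, mul_zero]
      rw [hp' 0 (j + 1) hjn, hq 1 (j + 1) hjn, h3, hoff 0 (j + 1) (by omega) (by omega) (by omega)]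
        at h2
      simp only [hM, zero_add] at h2
      push_cast at h2
      have h4 : ((j + 1 + 1 : ℕ) : 𝕜) * t 1 (j + 1 + 1) = 0 := by
        push_cast
        linear_combination h2
      exact (mul_eq_zero.1 h4).resolve_left (by exact_mod_cast Nat.succ_ne_zero (j + 1))
  refine eqOn_linearForms (A := T) (B := LinearMap.id) (fun j hj => ?_) hp
  rw [LinearMap.id_apply]
  cases j with
  | zero => exact h0
  | succ j =>
    have h2 (i : ℕ) (hi : i ≠ j + 1) : (coord i (T (var 𝕜 n (j + 1))) : 𝕜) = 0 := by
      rcases eq_or_ne i 1 with rfl | hi1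
      · exact hone _ (by omega) hj
      · exact hoff _ _ hi1 hi hj
    rw [eq_smul_var (hv _) h2]
    exact (congrArg (· • var 𝕜 n (j + 1)) (hdiag j hj)).trans (one_smul _ _)

/-! ### Graded Poisson maps -/

section Poisson

theorem bracket_var_zero (a : 𝕜) (p : Poly 𝕜 n) :
    bracket n a p (var 𝕜 n 0) = a • (var 𝕜 n 0 * downDer 𝕜 n p) := by
  rw [bracket, eulerDer_var, downDer_var_zero]
  simp [mul_comm]

theorem bracket_var_one (hn : 1 ≤ n) (a : 𝕜) (p : Poly 𝕜 n) :
    bracket n a p (var 𝕜 n 1) =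
      (a + 1) • (var 𝕜 n 1 * downDer 𝕜 n p) - var 𝕜 n 0 * eulerDer n a p := by
  rw [bracket, eulerDer_var, downDer_var_succ hn]
  simp [mul_comm]

theorem bracket_comm (a : 𝕜) (p q : Poly 𝕜 n) : bracket n a p q = -bracket n a q p := by
  rw [bracket, bracket]
  ring

variable [CharZero 𝕜]

theorem coord_eq_zero_of_mul_eq_var_zero_mul {y w : Poly 𝕜 n} (hy : y ∈ linearForms 𝕜 n)
    (hw : w ∈ linearForms 𝕜 n) (hy0 : y ≠ 0) (h : y * w = var 𝕜 n 0 * downDer 𝕜 n y) :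
    ∀ i, i ≠ 0 → (coord i y : 𝕜) = 0 := by
  obtain ⟨s, -, hs, hs'⟩ := exists_top_coord hy hy0
  rcases Nat.eq_zero_or_pos s with rfl | hspos
  · exact fun i hi => hs' i (by omega)
  exfalso
  obtain ⟨s, rfl⟩ := Nat.exists_eq_add_of_le' hspos
  have hDy : downDer 𝕜 n y ≠ 0 := fun h0 => hs (by
    rw [← coord_downDer _ hy, h0, map_zero])
  have hw0 : w ≠ 0 := by
    rintro rfl
    rw [mul_zero] at h
    exact mul_ne_zero (var_ne_zero (Nat.zero_le n)) hDy h.symm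
  obtain ⟨r, -, hr, hr'⟩ := exists_top_coord hw hw0
  rcases Nat.eq_zero_or_pos r with rfl | hrpos
  · have h1 : var 𝕜 n 0 * ((coord 0 w : 𝕜) • y - downDer 𝕜 n y) = 0 := by
      rw [eq_smul_var (k := 0) hw fun i hi => hr' i (by omega), mul_smul_comm] at h
      rw [mul_sub, ← h, mul_smul_comm, mul_comm y, sub_self]
    have h2 := (mul_eq_zero.1 h1).resolve_left (var_ne_zero (Nat.zero_le n))
    have h3 := congrArg (coord (s + 1)) h2
    rw [map_sub, map_smul, coord_downDer _ hy, hs' (s + 1 + 1) (by omega)] at h3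
    simp [hr, hs] at h3
  · refine coord₂_mul_ne_zero hy hw hs hs' hr hr' ?_
    rw [h]
    exact coord₂_var_mul (Nat.zero_le n) (by omega) (by omega) (downDer_mem hy)

theorem coord_eq_zero_of_mul_eq_var_one_mul (hn : 1 ≤ n) {y w z : Poly 𝕜 n}
    (hy : y ∈ linearForms 𝕜 n) (hw : w ∈ linearForms 𝕜 n) (hz : z ∈ linearForms 𝕜 n)
    (h : y * w = var 𝕜 n 0 * z - var 𝕜 n 1 * downDer 𝕜 n y) :
    ∀ i, 2 ≤ i → (coord i y : 𝕜) = 0 := by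
  by_cases hy0 : y = 0
  · intro i _
    rw [hy0, map_zero]
  obtain ⟨s, -, hs, hs'⟩ := exists_top_coord hy hy0
  rcases Nat.lt_or_ge s 2 with hs2 | hs2
  · exact fun i hi => hs' i (by omega)
  exfalso
  obtain ⟨s, rfl⟩ := Nat.exists_eq_add_of_le' (show 1 ≤ s by omega)
  have hr : ∀ r, 2 ≤ r → (coord r w : 𝕜) = 0 := by
    by_cases hw0 : w = 0
    · intro r _
      rw [hw0, map_zero]
    obtain ⟨r, -, hr, hr'⟩ := exists_top_coord hw hw0
    rcases Nat.lt_or_ge r 2 with hr2 | hr2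
    · exact fun i hi => hr' i (by omega)
    · exfalso
      refine coord₂_mul_ne_zero hy hw hs hs' hr hr' ?_
      rw [h, map_sub, coord₂_var_mul (Nat.zero_le n) (by omega) (by omega) hz,
        coord₂_var_mul hn (by omega) (by omega) (downDer_mem hy), sub_zero]
  have h1 : var 𝕜 n 1 * ((coord 1 w : 𝕜) • y + downDer 𝕜 n y) =
      var 𝕜 n 0 * (z - (coord 0 w : 𝕜) • y) := by
    rw [eq_smul_var_add hn hw hr, mul_add, mul_smul_comm, mul_smul_comm] at h
    rw [mul_add, mul_sub, mul_smul_comm, mul_smul_comm, mul_comm _ y, mul_comm _ y]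
    linear_combination h
  have h2 := (coord_of_var_mul_eq hn
    (add_mem (Submodule.smul_mem _ _ hy) (downDer_mem hy))
    (sub_mem hz (Submodule.smul_mem _ _ hy)) h1).1
  have h3 := h2 (s + 1) (by omega)
  rw [map_add, map_smul, coord_downDer _ hy, hs' (s + 1 + 1) (by omega), add_zero, smul_eq_mul] at h3
  have h4 := h2 s (by omega)
  rw [map_add, map_smul, coord_downDer _ hy, (mul_eq_zero.1 h3).resolve_right hs, zero_smul,
    zero_add] at h4
  exact hs h4

variable {a : 𝕜} {T : Poly 𝕜 n ≃ₐ[𝕜] Poly 𝕜 n}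

theorem poisson_map_var_zero
    (hV : ∀ p, T p ∈ linearForms 𝕜 n ↔ p ∈ linearForms 𝕜 n)
    (hT : ∀ p q, T (bracket n a p q) = bracket n a (T p) (T q))
    (h : 2 ≤ n ∨ (n = 1 ∧ a ≠ 0)) :
    ∃ l : 𝕜, T (var 𝕜 n 0) = l • var 𝕜 n 0 := by
  have hy : T (var 𝕜 n 0) ∈ linearForms 𝕜 n := (hV _).2 (var_mem 0)
  refine ⟨_, eq_smul_var hy ?_⟩
  by_cases ha : a = 0
  · subst ha
    have hn : 2 ≤ n := by tauto
    have hc (p : Poly 𝕜 n) : bracket n 0 p (T (var 𝕜 n 0)) = 0 := by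
      rw [← T.apply_symm_apply p, ← hT, bracket_var_zero, zero_smul, map_zero]
    have h1 := hc (var 𝕜 n 1)
    have h2 := hc (var 𝕜 n 2)
    rw [bracket, downDer_var_succ (by omega), eulerDer_var] at h1 h2
    have hD := (coord_of_var_mul_eq (by omega) (downDer_mem hy) (eulerDer_mem 0 hy) (by
      simp only [Nat.cast_one, zero_add, one_smul] at h1
      linear_combination -h1)).1
    intro i hi
    rcases eq_or_ne i 1 with rfl | hi1
    · have h3 := congrArg (coord₂ 1 1) h2
      rw [smul_mul_assoc, map_sub, map_smul, coord₂_var_mul hn (by omega) (by omega)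
        (downDer_mem hy), coord₂_mul _ _ (var_mem 1) (eulerDer_mem 0 hy), coord_eulerDer _ _ hy,
        coord_var (by omega)] at h3
      simp only [if_true, smul_zero, sub_zero, map_zero, Nat.cast_one, zero_add, one_mul,
        ← two_mul] at h3
      exact (mul_eq_zero.1 h3).resolve_left two_ne_zero
    · obtain ⟨i, rfl⟩ := Nat.exists_eq_add_of_le' (Nat.pos_of_ne_zero hi)
      rw [← coord_downDer _ hy]
      exact hD i (by omega)
  · have hq : T.symm (var 𝕜 n 0) ∈ linearForms 𝕜 n := by
      rw [← hV, T.apply_symm_apply]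
      exact var_mem 0
    refine coord_eq_zero_of_mul_eq_var_zero_mul (w := -T (downDer 𝕜 n (T.symm (var 𝕜 n 0)))) hy
      (neg_mem ((hV _).2 (downDer_mem hq))) (by simpa using var_ne_zero (Nat.zero_le n)) ?_
    have h1 := hT (T.symm (var 𝕜 n 0)) (var 𝕜 n 0)
    rw [T.apply_symm_apply, bracket_var_zero, bracket_comm, bracket_var_zero, map_smul, map_mul,
      ← smul_neg] at h1
    rw [mul_neg, smul_right_injective _ ha h1, neg_neg]

theorem poisson_commute_downDer
    (hT : ∀ p q, T (bracket n a p q) = bracket n a (T p) (T q))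
    (ha : a ≠ 0) {l : 𝕜} (h0 : T (var 𝕜 n 0) = l • var 𝕜 n 0)
    (p : Poly 𝕜 n) : T (downDer 𝕜 n p) = downDer 𝕜 n (T p) := by
  have h1 := hT p (var 𝕜 n 0)
  have hl : T (var 𝕜 n 0) ≠ 0 := by simpa using var_ne_zero (Nat.zero_le n)
  have h2 : bracket n a (T p) (T (var 𝕜 n 0)) = a • (T (var 𝕜 n 0) * downDer 𝕜 n (T p)) := by
    rw [h0, bracket, Derivation.map_smul, Derivation.map_smul, eulerDer_var, downDer_var_zero]
    simp [mul_comm, smul_comm a l]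
  rw [h2, bracket_var_zero, map_smul, map_mul] at h1
  exact mul_left_cancel₀ hl (smul_right_injective _ ha h1)

theorem poisson_map_var_one
    (hV : ∀ p, T p ∈ linearForms 𝕜 n ↔ p ∈ linearForms 𝕜 n)
    (hT : ∀ p q, T (bracket n a p q) = bracket n a (T p) (T q))
    (h : 2 ≤ n ∨ (n = 1 ∧ a ≠ 0)) :
    ∃ m c : 𝕜, T (var 𝕜 n 1) = m • var 𝕜 n 1 + c • var 𝕜 n 0 := by
  have hn : 1 ≤ n := by omega
  have hy : T (var 𝕜 n 1) ∈ linearForms 𝕜 n := (hV _).2 (var_mem 1)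
  obtain ⟨l, hl⟩ := poisson_map_var_zero hV hT h
  suffices hc : ∀ i, 2 ≤ i → (coord i (T (var 𝕜 n 1)) : 𝕜) = 0 from
    ⟨_, _, (eq_smul_var_add hn hy hc).trans (add_comm _ _)⟩
  by_cases ha : a = 0
  · subst ha
    have hq : T.symm (var 𝕜 n 1) ∈ linearForms 𝕜 n := by
      rw [← hV, T.apply_symm_apply]
      exact var_mem 1
    refine coord_eq_zero_of_mul_eq_var_one_mul hn
      (w := T (downDer 𝕜 n (T.symm (var 𝕜 n 1))))
      (z := eulerDer n 0 (T (var 𝕜 n 1)) + l • T (eulerDer n 0 (T.symm (var 𝕜 n 1)))) hy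
      ((hV _).2 (downDer_mem hq)) (add_mem (eulerDer_mem 0 hy)
        (Submodule.smul_mem _ _ ((hV _).2 (eulerDer_mem 0 hq)))) ?_
    have h1 := hT (T.symm (var 𝕜 n 1)) (var 𝕜 n 1)
    rw [T.apply_symm_apply, bracket_var_one hn, bracket_comm, bracket_var_one hn, map_sub, map_smul,
      map_mul, map_mul, hl, smul_mul_assoc] at h1
    simp only [zero_add, one_smul] at h1
    rw [mul_add, mul_smul_comm]
    linear_combination h1
  · intro i hi
    obtain ⟨i, rfl⟩ := Nat.exists_eq_add_of_le' (show 1 ≤ i by omega)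
    rw [← coord_downDer _ hy, ← poisson_commute_downDer hT ha hl, downDer_var_succ hn, hl,
      map_smul, coord_var (Nat.zero_le n), if_neg (by omega), smul_zero]

theorem poisson_eq_self
    (hV : ∀ p, T p ∈ linearForms 𝕜 n ↔ p ∈ linearForms 𝕜 n)
    (hT : ∀ p q, T (bracket n a p q) = bracket n a (T p) (T q))
    (h : 2 ≤ n ∨ (n = 1 ∧ a ≠ 0)) {m : 𝕜} (h0 : T (var 𝕜 n 0) = var 𝕜 n 0)
    (h1 : T (var 𝕜 n 1) = m • var 𝕜 n 1) {p : Poly 𝕜 n} (hp : p ∈ linearForms 𝕜 n) : T p = p := by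
  have hn : 1 ≤ n := by omega
  have hm : m ≠ 0 := by
    rintro rfl
    rw [zero_smul] at h1
    exact var_ne_zero hn ((map_eq_zero_iff T T.injective).1 h1)
  have key (p : Poly 𝕜 n) : m • ((a + 1) • (var 𝕜 n 1 * downDer 𝕜 n (T p)) -
      var 𝕜 n 0 * eulerDer n a (T p)) =
      (a + 1) • m • (var 𝕜 n 1 * T (downDer 𝕜 n p)) - var 𝕜 n 0 * T (eulerDer n a p) := by
    have h2 := hT p (var 𝕜 n 1)
    rw [bracket_var_one hn, map_sub, map_smul, map_mul, map_mul, h0, h1, smul_mul_assoc] at h2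
    rw [h2, ← bracket_var_one hn, bracket, bracket, Derivation.map_smul, Derivation.map_smul,
      mul_smul_comm, mul_smul_comm, smul_sub]
  by_cases ha : a = 0
  · subst ha
    refine eq_self_of_commute_mod (T := T.toLinearMap) (by tauto) 0 m (fun p hp => (hV p).2 hp) hm
      h0 h1 (fun p _ => ?_) hp
    have h2 := key p
    simp only [zero_add, one_smul] at h2
    simp only [AlgEquiv.toLinearMap_apply, zero_smul, add_zero, mul_sub, smul_sub, mul_smul_comm]
    rw [smul_sub] at h2
    linear_combination h2
  · have hD := poisson_commute_downDer hT ha (l := 1) (by rw [h0, one_smul])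
    have hm1 : m = 1 := by
      have h2 := congrArg (coord 0) (hD (var 𝕜 n 1))
      rw [h1, Derivation.map_smul, downDer_var_succ hn, h0, map_smul, coord_var (Nat.zero_le n)]
        at h2
      simpa using h2.symm
    subst hm1
    refine eq_self_of_commute a (T := T.toLinearMap) (fun p hp => (hV p).2 hp) h0
      (fun p _ => hD p) (fun p _ => ?_) hp
    have h2 := key p
    rw [one_smul, one_smul, hD] at h2
    exact mul_left_cancel₀ (var_ne_zero (Nat.zero_le n)) (sub_right_injective h2).symm

end Poisson

end

section

variable {𝕜 : Type*} [Field 𝕜] {n : ℕ}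

/-! ### The operators `(1 + Δ)^z` -/

/-- The operator `(1 + Δ)^z = ∑_k binom(z, k) Δ^k`. -/
def phi (z : 𝕜) : Poly 𝕜 n →ₗ[𝕜] Poly 𝕜 n := series (PowerSeries.mk (binom z))

theorem phi_eq_phiTrunc (z : 𝕜) {f : Poly 𝕜 n} {N : ℕ} (h : downPow n N f = 0) :
    phi z f = phiTrunc z N f := by
  rw [phi, series_eq_sum _ h, phiTrunc]
  simp

theorem star_eq_phi_mul {a z : 𝕜} (f : Poly 𝕜 n) {g : Poly 𝕜 n} (hg : eulerDer n a g = z • g) :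
    star n a f g = phi z f * g := by
  obtain ⟨N, hN⟩ := exists_downPow_eq_zero f
  rw [star_eigen hN hg, phi_eq_phiTrunc z hN]

theorem star_var (a : 𝕜) (f : Poly 𝕜 n) (i : ℕ) :
    star n a f (var 𝕜 n i) = phi (a + i) f * var 𝕜 n i :=
  star_eq_phi_mul f (eulerDer_var a i)

theorem phi_mem (z : 𝕜) {p : Poly 𝕜 n} (hp : p ∈ linearForms 𝕜 n) :
    phi z p ∈ linearForms 𝕜 n := series_mem _ hp

theorem coord_phi_top (z : 𝕜) {p : Poly 𝕜 n} (hp : p ∈ linearForms 𝕜 n) {r : ℕ}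
    (h : ∀ i, r < i → (coord i p : 𝕜) = 0) : (coord r (phi z p) : 𝕜) = coord r p := by
  rw [phi, coord_series_top _ hp h, PowerSeries.coeff_mk, binom_zero, one_mul]

theorem coord_phi_pred (hn : 1 ≤ n) (z : 𝕜) {p : Poly 𝕜 n} (hp : p ∈ linearForms 𝕜 n) {r : ℕ}
    (h : ∀ i, r + 1 < i → (coord i p : 𝕜) = 0) :
    (coord r (phi z p) : 𝕜) = coord r p + z * coord (r + 1) p := by
  rw [phi, coord_series_pred hn _ hp h, PowerSeries.coeff_mk, PowerSeries.coeff_mk, binom_zero,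
    binom_one, one_mul]

theorem phi_zero (f : Poly 𝕜 n) : phi 0 f = f := by
  have : PowerSeries.mk (binom (0 : 𝕜)) = 1 := by
    ext k
    rw [PowerSeries.coeff_mk, PowerSeries.coeff_one, binom, descPochhammer_eval_zero]
    split_ifs with h
    · simp [h]
    · simp
  rw [phi, this, series_one]

theorem phi_apply_one (c : 𝕜) : phi c (1 : Poly 𝕜 n) = 1 := by
  rw [phi, series_eq_sum (N := 1) _ (by simp [downPow_one])]
  simp [downPow_zero, binom_zero]

theorem phi_var_zero (z : 𝕜) : phi z (var 𝕜 n 0) = var 𝕜 n 0 := by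
  rw [phi, series_var_zero, PowerSeries.coeff_mk, binom_zero, one_smul]

theorem phi_var_one (hn : 1 ≤ n) (z : 𝕜) : phi z (var 𝕜 n 1) = var 𝕜 n 1 + z • var 𝕜 n 0 := by
  rw [phi, series_var_one hn, PowerSeries.coeff_mk, PowerSeries.coeff_mk, binom_zero, binom_one,
    one_smul]

theorem phi_var (z : 𝕜) {j : ℕ} (hj : j ≤ n) :
    phi z (var 𝕜 n j) = ∑ k ∈ Finset.range (j + 1), binom z k • var 𝕜 n (j - k) := by
  rw [phi, series_eq_sum (N := j + 1) _ (by rw [downPow_var hj, if_neg (by omega)])]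
  refine Finset.sum_congr rfl fun k hk => ?_
  rw [PowerSeries.coeff_mk, downPow_var hj, if_pos (by simpa [Nat.lt_succ_iff] using hk)]

theorem coord₂_star (a : 𝕜) {y w : Poly 𝕜 n} (hy : y ∈ linearForms 𝕜 n)
    (hw : w ∈ linearForms 𝕜 n) {s r : ℕ} (hs : ∀ i, s < i → (coord i y : 𝕜) = 0)
    (hr : ∀ i, r < i → (coord i w : 𝕜) = 0) :
    (coord₂ s r (star n a y w) : 𝕜) = coord₂ s r (y * w) := by
  rw [star_eq_sum a (downPow_linearForm hy), map_sum, Finset.sum_eq_single 0]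
  · rw [downPow_zero, binomEuler_zero]
  · intro k _ hk
    rw [coord₂_mul _ _ (downPow_mem k hy) (binomEuler_mem a k hw), coord_downPow _ _ hy,
      coord_downPow _ _ hy, coord_binomEuler _ _ _ hw, coord_binomEuler _ _ _ hw,
      hs (s + k) (by omega)]
    rcases le_or_gt s r with h | h
    · rw [hs (r + k) (by omega)]
      ring
    · rw [hr s h]
      ring
  · simp

theorem star_var_zero (a : 𝕜) (f : Poly 𝕜 n) :
    star n a f (var 𝕜 n 0) = star n a (var 𝕜 n 0) (phi a f) := by
  rw [star_var, var_zero_star, Nat.cast_zero, add_zero, mul_comm]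

theorem star_commute_phi {a : 𝕜} {T : Poly 𝕜 n ≃ₗ[𝕜] Poly 𝕜 n}
    (hT : ∀ p q, T (star n a p q) = star n a (T p) (T q)) {l : 𝕜}
    (h0 : T (var 𝕜 n 0) = l • var 𝕜 n 0) (p : Poly 𝕜 n) : T (phi a p) = phi a (T p) := by
  have h1 := hT p (var 𝕜 n 0)
  have hl : T (var 𝕜 n 0) ≠ 0 := by simpa using var_ne_zero (Nat.zero_le n)
  rw [star_var_zero, hT, h0, star_smul, smul_star, star_var_zero, var_zero_star, var_zero_star,
    ← smul_mul_assoc, ← smul_mul_assoc, ← h0] at h1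
  exact mul_left_cancel₀ hl h1

section CharZero

variable [CharZero 𝕜]

theorem phi_add (z w : 𝕜) (f : Poly 𝕜 n) : phi (z + w) f = phi z (phi w f) := by
  have hs : PowerSeries.mk (binom (z + w)) =
      PowerSeries.mk (binom z) * PowerSeries.mk (binom w) := by
    ext k
    rw [PowerSeries.coeff_mul, PowerSeries.coeff_mk, binom_eq_choose,
      Ring.add_choose_eq k (Commute.all z w)]
    simp only [PowerSeries.coeff_mk, binom_eq_choose]
  rw [phi, hs, series_mul, phi, phi]

theorem phi_neg_phi (z : 𝕜) (f : Poly 𝕜 n) : phi (-z) (phi z f) = f := by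
  rw [← phi_add, neg_add_cancel, phi_zero]

theorem phi_phi_neg (z : 𝕜) (f : Poly 𝕜 n) : phi z (phi (-z) f) = f := by
  rw [← phi_add, add_neg_cancel, phi_zero]

theorem phi_one (f : Poly 𝕜 n) : phi 1 f = f + downDer 𝕜 n f := by
  have hs : PowerSeries.mk (binom (1 : 𝕜)) = 1 + PowerSeries.X := by
    ext k
    rw [PowerSeries.coeff_mk, binom_eq_choose, ← Nat.cast_one, Ring.choose_natCast, map_add,
      PowerSeries.coeff_one, PowerSeries.coeff_X]
    match k with
    | 0 => simp
    | 1 => simp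
    | k + 2 => simp [Nat.choose_eq_zero_of_lt]
  obtain ⟨N, hN⟩ := exists_downPow_eq_zero f
  rw [phi, hs, series_eq_sum _ (downPow_eq_zero_of_le hN (Nat.le_add_right N 2)),
    ← Finset.sum_subset (Finset.range_mono (Nat.le_add_left 2 N))]
  · simp [Finset.sum_range_succ, downPow_zero, downPow_one, PowerSeries.coeff_X,
      PowerSeries.coeff_one]
  · intro k _ hk
    simp only [Finset.mem_range, not_lt] at hk
    rw [map_add, PowerSeries.coeff_one, PowerSeries.coeff_X, if_neg (by omega), if_neg (by omega),
      add_zero, zero_smul]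

/-- The operators `(1 + Δ)^z` are multiplicative for the product of `R(n,a)`. -/
theorem phi_star (a z : 𝕜) (f g : Poly 𝕜 n) :
    phi z (star n a f g) = star n a (phi z f) (phi z g) := by
  induction g using MvPolynomial.induction_on' with
  | add p q hp hq => simp only [star_add, map_add, hp, hq]
  | monomial s c =>
    obtain ⟨w, hw⟩ := exists_eulerDer_monomial a s
    set g := MvPolynomial.monomial s c
    have hg : eulerDer n a g = w • g := hw c
    obtain ⟨N, hN⟩ := exists_downPow_eq_zero f
    obtain ⟨K, hK⟩ := exists_downPow_eq_zero g
    have hF : downPow n N (phi w f) = 0 := by rw [phi, downPow_series, hN, map_zero]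
    have hFg : downPow n (N + K) (phi w f * g) = 0 := by
      rw [downPow_mul]
      refine Finset.sum_eq_zero fun p hp => ?_
      have hp' := Finset.HasAntidiagonal.mem_antidiagonal.1 hp
      rcases le_or_gt N p.1 with h | h
      · rw [downPow_eq_zero_of_le hF h, zero_mul, smul_zero]
      · rw [downPow_eq_zero_of_le hK (by omega), mul_zero, smul_zero]
    rw [star_eq_phi_mul f hg, phi_eq_phiTrunc z hFg, phiTrunc_mul z hF hK, phi_eq_phiTrunc z hK,
      phiTrunc, star_sum]
    refine Finset.sum_congr rfl fun q _ => ?_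
    rw [star_smul, star_eq_phi_mul _ (eulerDer_downPow hg q), ← phi_eq_phiTrunc _ hF, ← phi_add,
      ← phi_add]
    congr 4
    ring

/-! ### Graded maps for the product of `R(n,a)` -/

theorem coord_eq_zero_of_star_eq_var_zero_mul (hn : 1 ≤ n) {a : 𝕜} (ha : a ≠ 0) {y w : Poly 𝕜 n}
    (hy : y ∈ linearForms 𝕜 n) (hw : w ∈ linearForms 𝕜 n) (hy0 : y ≠ 0)
    (h : star n a y w = var 𝕜 n 0 * y) : ∀ i, i ≠ 0 → (coord i y : 𝕜) = 0 := by
  obtain ⟨s, -, hs, hs'⟩ := exists_top_coord hy hy0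
  rcases Nat.eq_zero_or_pos s with rfl | hspos
  · exact fun i hi => hs' i (by omega)
  exfalso
  obtain ⟨s, rfl⟩ := Nat.exists_eq_add_of_le' hspos
  have hw0 : w ≠ 0 := by
    rintro rfl
    rw [star_zero] at h
    exact mul_ne_zero (var_ne_zero (Nat.zero_le n)) hy0 h.symm
  obtain ⟨r, -, hr, hr'⟩ := exists_top_coord hw hw0
  rcases Nat.eq_zero_or_pos r with rfl | hrpos
  · have h1 : var 𝕜 n 0 * ((coord 0 w : 𝕜) • phi a y - y) = 0 := by
      rw [eq_smul_var (k := 0) hw fun i hi => hr' i (by omega), star_smul, star_var, Nat.cast_zero,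
        add_zero] at h
      rw [mul_sub, ← h, mul_smul_comm, mul_comm (var 𝕜 n 0), sub_self]
    have h2 := (mul_eq_zero.1 h1).resolve_left (var_ne_zero (Nat.zero_le n))
    have h3 := congrArg (coord (s + 1)) h2
    rw [map_sub, map_smul, coord_phi_top a hy hs', map_zero, smul_eq_mul, ← sub_one_mul] at h3
    have h4 := sub_eq_zero.1 ((mul_eq_zero.1 h3).resolve_right hs)
    have h5 := congrArg (coord s) h2
    rw [map_sub, map_smul, coord_phi_pred hn a hy hs', map_zero, h4, one_smul, add_sub_cancel_left]
      at h5
    exact mul_ne_zero ha hs h5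
  · refine coord₂_mul_ne_zero hy hw hs hs' hr hr' ?_
    rw [← coord₂_star a hy hw hs' hr', h]
    exact coord₂_var_mul (Nat.zero_le n) (by omega) (by omega) hy

theorem coord_eq_zero_of_star_eq_var_one_mul (hn : 1 ≤ n) {y w z : Poly 𝕜 n}
    (hy : y ∈ linearForms 𝕜 n) (hw : w ∈ linearForms 𝕜 n) (hz : z ∈ linearForms 𝕜 n)
    (h : star n 0 y w = var 𝕜 n 1 * y + var 𝕜 n 0 * z) :
    ∀ i, 2 ≤ i → (coord i y : 𝕜) = 0 := by
  by_cases hy0 : y = 0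
  · intro i _
    rw [hy0, map_zero]
  obtain ⟨s, -, hs, hs'⟩ := exists_top_coord hy hy0
  rcases Nat.lt_or_ge s 2 with hs2 | hs2
  · exact fun i hi => hs' i (by omega)
  exfalso
  obtain ⟨s, rfl⟩ := Nat.exists_eq_add_of_le' (show 1 ≤ s by omega)
  have hr : ∀ r, 2 ≤ r → (coord r w : 𝕜) = 0 := by
    by_cases hw0 : w = 0
    · intro r _
      rw [hw0, map_zero]
    obtain ⟨r, -, hr, hr'⟩ := exists_top_coord hw hw0
    rcases Nat.lt_or_ge r 2 with hr2 | hr2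
    · exact fun i hi => hr' i (by omega)
    · exfalso
      refine coord₂_mul_ne_zero hy hw hs hs' hr hr' ?_
      rw [← coord₂_star 0 hy hw hs' hr', h, map_add,
        coord₂_var_mul (Nat.zero_le n) (by omega) (by omega) hz,
        coord₂_var_mul hn (by omega) (by omega) hy, add_zero]
  have h1 : var 𝕜 n 1 * ((coord 1 w : 𝕜) • phi 1 y - y) =
      var 𝕜 n 0 * (z - (coord 0 w : 𝕜) • y) := by
    rw [eq_smul_var_add hn hw hr, star_add, star_smul, star_smul, star_var, star_var,
      Nat.cast_zero, Nat.cast_one, zero_add, zero_add, phi_zero] at h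
    rw [mul_sub, mul_sub, mul_smul_comm, mul_smul_comm, mul_comm _ (phi 1 y),
      mul_comm (var 𝕜 n 0) y]
    linear_combination h
  have h2 := (coord_of_var_mul_eq hn (sub_mem (Submodule.smul_mem _ _ (phi_mem 1 hy)) hy)
    (sub_mem hz (Submodule.smul_mem _ _ hy)) h1).1
  have h3 := h2 (s + 1) (by omega)
  rw [map_sub, map_smul, coord_phi_top 1 hy hs', smul_eq_mul, ← sub_one_mul] at h3
  have h4 := h2 s (by omega)
  rw [map_sub, map_smul, coord_phi_pred hn 1 hy hs',
    sub_eq_zero.1 ((mul_eq_zero.1 h3).resolve_right hs), one_smul, one_mul,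
    add_sub_cancel_left] at h4
  exact hs h4

/-- A linear map commuting with `(1 + Δ)^a` for some `a ≠ 0` commutes with all `(1 + Δ)^z`. -/
theorem commute_phi {a : 𝕜} (ha : a ≠ 0) {T : Poly 𝕜 n →ₗ[𝕜] Poly 𝕜 n}
    (hT : ∀ p ∈ linearForms 𝕜 n, T p ∈ linearForms 𝕜 n)
    (h : ∀ p ∈ linearForms 𝕜 n, T (phi a p) = phi a (T p)) (z : 𝕜) {p : Poly 𝕜 n}
    (hp : p ∈ linearForms 𝕜 n) : T (phi z p) = phi z (T p) := by
  have hnat (m : ℕ) : T (phi (m * a) p) = phi (m * a) (T p) := by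
    induction m with
    | zero => simp [phi_zero]
    | succ m ih =>
      rw [Nat.cast_succ, add_one_mul, add_comm _ a, phi_add, phi_add, h _ (phi_mem _ hp), ih]
  have hdiff (z : 𝕜) : T (phi z p) - phi z (T p) = ∑ k ∈ Finset.range (n + 1),
      binom z k • (T (downPow n k p) - downPow n k (T p)) := by
    rw [phi, series_linearForm _ hp, series_linearForm _ (hT p hp), map_sum,
      ← Finset.sum_sub_distrib]
    refine Finset.sum_congr rfl fun k _ => ?_
    rw [map_smul, PowerSeries.coeff_mk, smul_sub]
  rw [← sub_eq_zero]
  ext s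
  rw [coeff_zero]
  set Q : Polynomial 𝕜 := ∑ k ∈ Finset.range (n + 1), Polynomial.C ((k.factorial : 𝕜)⁻¹ *
    coeff s (T (downPow n k p) - downPow n k (T p))) * descPochhammer 𝕜 k with hQ
  have heval (z : 𝕜) : Q.eval z = coeff s (T (phi z p) - phi z (T p)) := by
    rw [hdiff, hQ, Polynomial.eval_finsetSum, coeff_sum]
    refine Finset.sum_congr rfl fun k _ => ?_
    rw [Polynomial.eval_mul, Polynomial.eval_C, coeff_smul, binom, smul_eq_mul]
    ring
  have hQ0 : Q = 0 := by
    refine Polynomial.eq_zero_of_infinite_isRoot Q (Set.Infinite.mono ?_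
      (Set.infinite_range_of_injective (f := fun m : ℕ => (m : 𝕜) * a) fun m m' hm => ?_))
    · rintro _ ⟨m, rfl⟩
      change Q.eval _ = 0
      rw [heval, hnat, sub_self, coeff_zero]
    · exact_mod_cast mul_right_cancel₀ ha hm
  rw [← heval, hQ0, Polynomial.eval_zero]

variable {a : 𝕜} {T : Poly 𝕜 n ≃ₗ[𝕜] Poly 𝕜 n}

theorem star_map_var_zero (hV : ∀ p, T p ∈ linearForms 𝕜 n ↔ p ∈ linearForms 𝕜 n)
    (hT : ∀ p q, T (star n a p q) = star n a (T p) (T q)) (h : 2 ≤ n ∨ (n = 1 ∧ a ≠ 0)) :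
    ∃ l : 𝕜, T (var 𝕜 n 0) = l • var 𝕜 n 0 := by
  have hy : T (var 𝕜 n 0) ∈ linearForms 𝕜 n := (hV _).2 (var_mem 0)
  refine ⟨_, eq_smul_var hy ?_⟩
  by_cases ha : a = 0
  · subst ha
    have hn : 2 ≤ n := by tauto
    have hc (p : Poly 𝕜 n) : star n 0 p (T (var 𝕜 n 0)) = star n 0 (T (var 𝕜 n 0)) p := by
      rw [← T.apply_symm_apply p, ← hT, ← hT, star_var, var_zero_star, Nat.cast_zero, zero_add,
        phi_zero, mul_comm]
    have h1 := hc (var 𝕜 n 1)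
    rw [var_one_star (by omega), star_var, Nat.cast_one, zero_add, phi_one] at h1
    have hD := (coord_of_var_mul_eq (by omega) (downDer_mem hy) (eulerDer_mem 0 hy) (by
      linear_combination -h1)).1
    intro i hi
    rcases eq_or_ne i 1 with rfl | hi1
    · have h2 := hc (var 𝕜 n 2)
      have hd1 : downPow n 1 (var 𝕜 n 2) = var 𝕜 n 1 := by rw [downPow_one, downDer_var_succ hn]
      have hd2 : downPow n 2 (var 𝕜 n 2) = var 𝕜 n 0 := by
        rw [downPow_succ, hd1, downDer_var_succ (by omega)]
      have h3 := congrArg (coord₂ 1 1) h2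
      rw [star_var, mul_comm _ (var 𝕜 n 2), coord₂_var_mul hn (by omega) (by omega) (phi_mem _ hy),
        star_eq_sum 0 (N := 3) (by rw [downPow_succ, hd2, downDer_var_zero])] at h3
      simp only [Finset.sum_range_succ, Finset.sum_range_zero, zero_add, map_add, downPow_zero,
        hd1, hd2, binomEuler_one] at h3
      rw [coord₂_var_mul hn (by omega) (by omega) (binomEuler_mem 0 0 hy),
        coord₂_var_mul (Nat.zero_le n) (by omega) (by omega) (binomEuler_mem 0 2 hy),
        coord₂_mul _ _ (var_mem 1) (eulerDer_mem 0 hy), coord_eulerDer _ _ hy,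
        coord_var (by omega)] at h3
      simp only [if_true, add_zero, Nat.cast_one, zero_add, one_mul, ← two_mul] at h3
      exact (mul_eq_zero.1 h3).resolve_left two_ne_zero
    · obtain ⟨i, rfl⟩ := Nat.exists_eq_add_of_le' (Nat.pos_of_ne_zero hi)
      rw [← coord_downDer _ hy]
      exact hD i (by omega)
  · have hq : T.symm (var 𝕜 n 0) ∈ linearForms 𝕜 n := by
      rw [← hV, T.apply_symm_apply]
      exact var_mem 0
    refine coord_eq_zero_of_star_eq_var_zero_mul (by omega) ha
      (w := T (phi a (T.symm (var 𝕜 n 0)))) hy ((hV _).2 (phi_mem a hq))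
      (by simpa using var_ne_zero (Nat.zero_le n)) ?_
    rw [← hT, ← star_var_zero, hT, T.apply_symm_apply, var_zero_star]

theorem star_commute_downDer (hV : ∀ p, T p ∈ linearForms 𝕜 n ↔ p ∈ linearForms 𝕜 n)
    (hT : ∀ p q, T (star n a p q) = star n a (T p) (T q)) (ha : a ≠ 0) {l : 𝕜}
    (h0 : T (var 𝕜 n 0) = l • var 𝕜 n 0) {p : Poly 𝕜 n} (hp : p ∈ linearForms 𝕜 n) :
    T (downDer 𝕜 n p) = downDer 𝕜 n (T p) := by
  have h1 := commute_phi (T := T.toLinearMap) ha (fun p hp => (hV p).2 hp)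
    (fun p _ => star_commute_phi hT h0 p) 1 hp
  simpa [phi_one] using h1

theorem star_map_var_one (hV : ∀ p, T p ∈ linearForms 𝕜 n ↔ p ∈ linearForms 𝕜 n)
    (hT : ∀ p q, T (star n a p q) = star n a (T p) (T q)) (h : 2 ≤ n ∨ (n = 1 ∧ a ≠ 0)) :
    ∃ m c : 𝕜, T (var 𝕜 n 1) = m • var 𝕜 n 1 + c • var 𝕜 n 0 := by
  have hn : 1 ≤ n := by omega
  have hy : T (var 𝕜 n 1) ∈ linearForms 𝕜 n := (hV _).2 (var_mem 1)
  obtain ⟨l, hl⟩ := star_map_var_zero hV hT h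
  suffices hc : ∀ i, 2 ≤ i → (coord i (T (var 𝕜 n 1)) : 𝕜) = 0 from
    ⟨_, _, (eq_smul_var_add hn hy hc).trans (add_comm _ _)⟩
  by_cases ha : a = 0
  · subst ha
    set q := T.symm (var 𝕜 n 1) with hq'
    have hq : q ∈ linearForms 𝕜 n := by
      rw [← hV, T.apply_symm_apply]
      exact var_mem 1
    refine coord_eq_zero_of_star_eq_var_one_mul hn (w := T (phi 1 q))
      (z := eulerDer n 0 (T (var 𝕜 n 1)) + l • T (eulerDer n 0 (phi 1 q))) hy
      ((hV _).2 (phi_mem 1 hq)) (add_mem (eulerDer_mem 0 hy)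
        (Submodule.smul_mem _ _ ((hV _).2 (eulerDer_mem 0 (phi_mem 1 hq))))) ?_
    have h1 := hT q (var 𝕜 n 1)
    have h2 : star n 0 q (var 𝕜 n 1) = star n 0 (var 𝕜 n 1) (phi 1 q) -
        star n 0 (var 𝕜 n 0) (eulerDer n 0 (phi 1 q)) := by
      rw [star_var, var_one_star hn, var_zero_star, Nat.cast_one, zero_add]
      ring
    rw [h2, map_sub, hT, hT, hl, smul_star, var_zero_star, T.apply_symm_apply, var_one_star hn]
      at h1
    rw [mul_add, mul_smul_comm]
    linear_combination h1
  · intro i hi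
    obtain ⟨i, rfl⟩ := Nat.exists_eq_add_of_le' (show 1 ≤ i by omega)
    rw [← coord_downDer _ hy, ← star_commute_downDer hV hT ha hl (var_mem 1), downDer_var_succ hn,
      hl, map_smul, coord_var (Nat.zero_le n), if_neg (by omega), smul_zero]

theorem star_eq_self (hV : ∀ p, T p ∈ linearForms 𝕜 n ↔ p ∈ linearForms 𝕜 n)
    (hT : ∀ p q, T (star n a p q) = star n a (T p) (T q)) (h : 2 ≤ n ∨ (n = 1 ∧ a ≠ 0)) {m : 𝕜}
    (h0 : T (var 𝕜 n 0) = var 𝕜 n 0) (h1 : T (var 𝕜 n 1) = m • var 𝕜 n 1) {p : Poly 𝕜 n}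
    (hp : p ∈ linearForms 𝕜 n) : T p = p := by
  have hn : 1 ≤ n := by omega
  have hm : m ≠ 0 := by
    rintro rfl
    rw [zero_smul] at h1
    exact var_ne_zero hn ((map_eq_zero_iff T T.injective).1 h1)
  have key (p : Poly 𝕜 n) : m • (phi (a + 1) (T p) * var 𝕜 n 1) =
      m • (var 𝕜 n 1 * T (phi (a + 1) p) + var 𝕜 n 0 * eulerDer n a (T (phi (a + 1) p))) -
        var 𝕜 n 0 * T (eulerDer n a (phi (a + 1) p)) := by
    have h2 := hT p (var 𝕜 n 1)
    have h3 : star n a p (var 𝕜 n 1) = star n a (var 𝕜 n 1) (phi (a + 1) p) -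
        star n a (var 𝕜 n 0) (eulerDer n a (phi (a + 1) p)) := by
      rw [star_var, var_one_star hn, var_zero_star, Nat.cast_one]
      ring
    rw [h3, map_sub, hT, hT, h0, h1, smul_star, star_smul, var_zero_star, var_one_star hn, star_var,
      Nat.cast_one] at h2
    exact h2.symm
  by_cases ha : a = 0
  · subst ha
    refine eq_self_of_commute_mod (T := T.toLinearMap) (by tauto) 1 m (fun p hp => (hV p).2 hp) hm
      h0 h1 (fun p _ => ?_) hp
    have h2 := key p
    rw [zero_add, phi_one, phi_one] at h2
    simp only [LinearEquiv.coe_coe, one_smul, mul_sub, smul_sub, mul_smul_comm]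
    rw [smul_add, add_mul, smul_add, map_add, mul_add, smul_add, mul_comm (T p),
      mul_comm (downDer 𝕜 n (T p))] at h2
    simp only [map_add] at h2 ⊢
    linear_combination h2
  · have hD {p : Poly 𝕜 n} (hp : p ∈ linearForms 𝕜 n) :=
      star_commute_downDer hV hT ha (l := 1) (by rw [h0, one_smul]) hp
    have hm1 : m = 1 := by
      have h2 := congrArg (coord 0) (hD (var_mem 1))
      rw [h1, Derivation.map_smul, downDer_var_succ hn, h0, map_smul, coord_var (Nat.zero_le n)]
        at h2
      simpa using h2.symm
    subst hm1
    refine eq_self_of_commute a (T := T.toLinearMap) (fun p hp => (hV p).2 hp) h0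
      (fun p hp => hD hp) (fun p hp => ?_) hp
    have h2 := key (phi (-(a + 1)) p)
    have h3 := commute_phi (T := T.toLinearMap) ha (fun p hp => (hV p).2 hp)
      (fun p _ => star_commute_phi hT (l := 1) (by rw [h0, one_smul]) p) (-(a + 1)) hp
    simp only [LinearEquiv.coe_coe] at h3 ⊢
    rw [one_smul, one_smul, h3, phi_phi_neg, phi_phi_neg] at h2
    refine mul_left_cancel₀ (var_ne_zero (𝕜 := 𝕜) (Nat.zero_le n)) ?_
    linear_combination h2

end CharZero

end

section

variable {𝕜 : Type*} [Field 𝕜] {n : ℕ}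

/-! ### Homogeneous components -/

/-- An injective linear map that preserves homogeneity of each degree also reflects it. -/
theorem isHomogeneous_iff_of_injective {T : Poly 𝕜 n →ₗ[𝕜] Poly 𝕜 n} (hT : Function.Injective T)
    (h : ∀ k f, f.IsHomogeneous k → (T f).IsHomogeneous k) (k : ℕ) (f : Poly 𝕜 n) :
    (T f).IsHomogeneous k ↔ f.IsHomogeneous k := by
  refine ⟨fun hf => ?_, h k f⟩
  have hcomp (i : ℕ) : homogeneousComponent i (T f) = T (homogeneousComponent i f) := by
    conv_lhs => rw [← sum_homogeneousComponent f]
    rw [map_sum, map_sum]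
    have hterm (j : ℕ) : homogeneousComponent i (T (homogeneousComponent j f)) =
        if i = j then T (homogeneousComponent j f) else 0 :=
      homogeneousComponent_of_mem (h j _ (homogeneousComponent_isHomogeneous j f))
    simp only [hterm, Finset.sum_ite_eq]
    split_ifs with hi
    · rfl
    · rw [homogeneousComponent_eq_zero _ _ (by simpa using hi), map_zero]
  rw [← sum_homogeneousComponent f]
  refine IsHomogeneous.sum _ _ _ fun i _ => ?_
  rcases eq_or_ne i k with rfl | hik
  · exact homogeneousComponent_isHomogeneous _ _
  · have h1 := hcomp i
    rw [homogeneousComponent_of_mem hf, if_neg hik] at h1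
    rw [(map_eq_zero_iff T hT).1 h1.symm]
    exact isHomogeneous_zero _ _ _

theorem isHomogeneous_downDer {k : ℕ} {f : Poly 𝕜 n} (hf : f.IsHomogeneous k) :
    (downDer 𝕜 n f).IsHomogeneous k := by
  have happ (D : Fin (n + 1) → Derivation 𝕜 (Poly 𝕜 n) (Poly 𝕜 n)) (g : Poly 𝕜 n) :
      (∑ i, D i) g = ∑ i, D i g :=
    (congrFun (map_sum Derivation.coeFnAddMonoidHom D Finset.univ) g).trans
      (Finset.sum_apply _ _ _)
  have hsum : downDer 𝕜 n = ∑ i : Fin (n + 1), downDer 𝕜 n (X i) • pderiv (R := 𝕜) i := by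
    refine derivation_ext fun j => ?_
    rw [happ, Finset.sum_eq_single j]
    · simp
    · intro i _ hij
      rw [Derivation.smul_apply, pderiv_X_of_ne hij.symm, smul_zero]
    · simp
  rcases Nat.eq_zero_or_pos k with rfl | hk
  · have h0 := totalDegree_eq_zero_iff_eq_C.1 (Nat.le_zero.1 hf.totalDegree_le)
    rw [h0]
    simp [isHomogeneous_zero]
  · rw [hsum, happ]
    refine IsHomogeneous.sum _ _ _ fun i _ => ?_
    rw [Derivation.smul_apply, smul_eq_mul, show k = 1 + (k - 1) by omega]
    refine IsHomogeneous.mul ?_ (by simpa using hf.pderiv)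
    rw [X_eq_var]
    exact downDer_mem (var_mem _)

theorem isHomogeneous_series (s : PowerSeries 𝕜) {k : ℕ} {f : Poly 𝕜 n} (hf : f.IsHomogeneous k) :
    (series s f).IsHomogeneous k := by
  obtain ⟨N, hN⟩ := exists_downPow_eq_zero f
  have hpow (j : ℕ) : (downPow n j f).IsHomogeneous k := by
    induction j with
    | zero => exact hf
    | succ j ih => rw [downPow_succ]; exact isHomogeneous_downDer ih
  rw [series_eq_sum s hN]
  exact Submodule.sum_mem (homogeneousSubmodule _ _ k) fun j _ => Submodule.smul_mem _ _ (hpow j)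

/-! ### Linear substitutions -/

/-- The substitution `X_i ↦ A X_i`. -/
def linSubst (A : Poly 𝕜 n →ₗ[𝕜] Poly 𝕜 n) : Poly 𝕜 n →ₐ[𝕜] Poly 𝕜 n := aeval fun j => A (X j)

theorem linSubst_apply (A : Poly 𝕜 n →ₗ[𝕜] Poly 𝕜 n) {p : Poly 𝕜 n} (hp : p ∈ linearForms 𝕜 n) :
    linSubst A p = A p := by
  refine eqOn_linearForms (A := (linSubst A).toLinearMap) (B := A) (fun i hi => ?_) hp
  rw [AlgHom.toLinearMap_apply, show i = ((⟨i, by omega⟩ : Fin (n + 1)) : ℕ) from rfl, ← X_eq_var,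
    linSubst, aeval_X]

/-- Two algebra maps out of the polynomial ring that agree on linear forms are equal. -/
theorem algHom_ext_linearForms {B : Type*} [Semiring B] [Algebra 𝕜 B] {F G : Poly 𝕜 n →ₐ[𝕜] B}
    (h : ∀ p ∈ linearForms 𝕜 n, F p = G p) : F = G :=
  algHom_ext fun _ => h _ (isHomogeneous_X _ _)

/-- A linear substitution with an inverse on linear forms. -/
def linSubstEquiv (A B : Poly 𝕜 n →ₗ[𝕜] Poly 𝕜 n)
    (hA : ∀ p ∈ linearForms 𝕜 n, A p ∈ linearForms 𝕜 n)
    (hB : ∀ p ∈ linearForms 𝕜 n, B p ∈ linearForms 𝕜 n)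
    (hAB : ∀ p ∈ linearForms 𝕜 n, A (B p) = p) (hBA : ∀ p ∈ linearForms 𝕜 n, B (A p) = p) :
    Poly 𝕜 n ≃ₐ[𝕜] Poly 𝕜 n :=
  AlgEquiv.ofAlgHom (linSubst A) (linSubst B)
    (algHom_ext_linearForms fun p hp => by
      rw [AlgHom.comp_apply, linSubst_apply B hp, linSubst_apply A (hB p hp), hAB p hp,
        AlgHom.id_apply])
    (algHom_ext_linearForms fun p hp => by
      rw [AlgHom.comp_apply, linSubst_apply A hp, linSubst_apply B (hA p hp), hBA p hp,
        AlgHom.id_apply])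

theorem mem_polyGradedAut {ψ : Poly 𝕜 n ≃ₐ[𝕜] Poly 𝕜 n}
    (h : ∀ p ∈ linearForms 𝕜 n, ψ p ∈ linearForms 𝕜 n) : ψ ∈ polyGradedAut 𝕜 n := by
  refine isHomogeneous_iff_of_injective (T := ψ.toLinearMap) ψ.injective fun k f hf => ?_
  have hψ : ψ.toAlgHom = aeval fun i => ψ (X i) := algHom_ext fun i => by simp
  have h1 := hf.aeval (n := 1) (fun i => ψ (X i)) fun i => h _ (isHomogeneous_X _ _)
  rw [← hψ, one_mul] at h1
  exact h1

theorem algEquiv_ext_linearForms {ψ χ : Poly 𝕜 n ≃ₐ[𝕜] Poly 𝕜 n}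
    (h : ∀ p ∈ linearForms 𝕜 n, ψ p = χ p) : ψ = χ :=
  AlgEquiv.ext fun p => DFunLike.congr_fun
    (algHom_ext_linearForms (F := ψ.toAlgHom) (G := χ.toAlgHom) h) p

/-- An algebra endomorphism intertwines two derivations as soon as it does so on the linear
forms. -/
theorem intertwine_derivation (σ : Poly 𝕜 n →ₐ[𝕜] Poly 𝕜 n)
    (d d' : Derivation 𝕜 (Poly 𝕜 n) (Poly 𝕜 n))
    (h : ∀ p ∈ linearForms 𝕜 n, σ (d p) = d' (σ p)) (f : Poly 𝕜 n) : σ (d f) = d' (σ f) := by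
  induction f using MvPolynomial.induction_on with
  | C c => rw [derivation_C, ← algebraMap_eq, AlgHom.commutes, Derivation.map_algebraMap, map_zero]
  | add p q hp hq => simp only [map_add, hp, hq]
  | mul_X p i hp =>
    simp only [Derivation.leibniz, map_add, map_mul, smul_eq_mul, hp, h _ (isHomogeneous_X 𝕜 i)]

/-! ### The graded Poisson automorphisms -/

section Poisson

variable [CharZero 𝕜]

/-- The operator `exp(c Δ)`. -/
def expDown (c : 𝕜) : Poly 𝕜 n →ₗ[𝕜] Poly 𝕜 n :=
  series (PowerSeries.rescale c (PowerSeries.exp 𝕜))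

theorem expDown_add (c d : 𝕜) (f : Poly 𝕜 n) : expDown (c + d) f = expDown c (expDown d f) := by
  rw [expDown, ← PowerSeries.exp_mul_exp_eq_exp_add, series_mul, expDown, expDown]

theorem expDown_zero (f : Poly 𝕜 n) : expDown 0 f = f := by
  have h : PowerSeries.rescale (0 : 𝕜) (PowerSeries.exp 𝕜) = 1 := by
    rw [PowerSeries.rescale_zero_apply, PowerSeries.constantCoeff_exp, map_one]
  rw [expDown, h, series_one]

theorem expDown_var_zero (c : 𝕜) : expDown c (var 𝕜 n 0) = var 𝕜 n 0 := by
  rw [expDown, series_var_zero, PowerSeries.coeff_rescale, PowerSeries.coeff_exp]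
  simp

theorem expDown_var_one (hn : 1 ≤ n) (c : 𝕜) :
    expDown c (var 𝕜 n 1) = var 𝕜 n 1 + c • var 𝕜 n 0 := by
  rw [expDown, series_var_one hn, PowerSeries.coeff_rescale, PowerSeries.coeff_exp,
    PowerSeries.coeff_rescale, PowerSeries.coeff_exp]
  simp

theorem eulerDer_downPow_apply (a : 𝕜) (k : ℕ) (f : Poly 𝕜 n) :
    eulerDer n a (downPow n k f) = downPow n k (eulerDer n a f) - (k : 𝕜) • downPow n k f := by
  induction k with
  | zero => simp [downPow_zero]
  | succ k ih =>
    rw [downPow_succ, eulerDer_down, ih, map_sub, Derivation.map_smul, ← downPow_succ,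
      Nat.cast_succ, add_smul, one_smul, downPow_succ k (eulerDer n a f)]
    abel

theorem eulerDer_expDown (a c : 𝕜) (f : Poly 𝕜 n) :
    eulerDer n a (expDown c f) =
      expDown c (eulerDer n a f) - c • downDer 𝕜 n (expDown c f) := by
  obtain ⟨N, hN⟩ := exists_downPow_eq_zero f
  obtain ⟨M, hM⟩ := exists_downPow_eq_zero (eulerDer n a f)
  have h1 := downPow_eq_zero_of_le hN (show N ≤ N + M + 1 by omega)
  have h2 := downPow_eq_zero_of_le hM (show M ≤ N + M + 1 by omega)
  have h3 := downPow_eq_zero_of_le hN (show N ≤ N + M by omega)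
  rw [expDown, series_eq_sum _ h1, series_eq_sum _ h2]
  conv_rhs => rw [← series_eq_sum _ h1, series_eq_sum _ h3]
  rw [map_sum, map_sum, Finset.smul_sum]
  simp only [Derivation.map_smul, eulerDer_downPow_apply, smul_sub, Finset.sum_sub_distrib]
  congr 1
  rw [Finset.sum_range_succ', Nat.cast_zero, zero_smul, smul_zero, add_zero]
  refine Finset.sum_congr rfl fun k _ => ?_
  rw [smul_smul, smul_smul, ← downPow_succ]
  congr 1
  rw [PowerSeries.coeff_rescale, PowerSeries.coeff_rescale, PowerSeries.coeff_exp,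
    PowerSeries.coeff_exp, Nat.factorial_succ, eq_ratCast, eq_ratCast]
  push_cast
  have h4 : (k : 𝕜) + 1 ≠ 0 := by exact_mod_cast Nat.succ_ne_zero k
  have h5 : (k.factorial : 𝕜) ≠ 0 := by exact_mod_cast k.factorial_ne_zero
  field_simp
  ring

/-- The substitution `X_j ↦ l exp(c Δ) X_j`. -/
def expEquiv (l : 𝕜ˣ) (c : 𝕜) : Poly 𝕜 n ≃ₐ[𝕜] Poly 𝕜 n :=
  linSubstEquiv ((l : 𝕜) • expDown c) ((l⁻¹ : 𝕜ˣ) • expDown (-c) : Poly 𝕜 n →ₗ[𝕜] Poly 𝕜 n)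
    (fun _ hp => Submodule.smul_mem _ _ (series_mem _ hp))
    (fun _ hp => Submodule.smul_mem _ _ (series_mem _ hp))
    (fun p _ => by
      simp only [LinearMap.smul_apply, Units.smul_def, map_smul, smul_smul, ← expDown_add]
      simp [expDown_zero])
    (fun p _ => by
      simp only [LinearMap.smul_apply, Units.smul_def, map_smul, smul_smul, ← expDown_add]
      simp [expDown_zero])

theorem expEquiv_apply (l : 𝕜ˣ) (c : 𝕜) {p : Poly 𝕜 n} (hp : p ∈ linearForms 𝕜 n) :
    expEquiv l c p = (l : 𝕜) • expDown c p :=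
  linSubst_apply ((l : 𝕜) • expDown c) hp

theorem expEquiv_mem (a : 𝕜) (l : 𝕜ˣ) (c : 𝕜) : expEquiv l c ∈ gradedPoissonAut n a := by
  refine ⟨fun f g => ?_, mem_polyGradedAut fun p hp => ?_⟩
  · have hD : ∀ f, expEquiv (n := n) l c (downDer 𝕜 n f) = downDer 𝕜 n (expEquiv l c f) :=
      intertwine_derivation (expEquiv (n := n) l c).toAlgHom (downDer 𝕜 n) (downDer 𝕜 n)
      fun p hp => by
        change expEquiv l c _ = downDer 𝕜 n (expEquiv l c p)
        rw [expEquiv_apply _ _ hp, expEquiv_apply _ _ (downDer_mem hp), Derivation.map_smul]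
        rw [expDown, downDer_series]
    have hE : ∀ f, expEquiv (n := n) l c (eulerDer n a f) =
        (eulerDer n a + c • downDer 𝕜 n) (expEquiv l c f) := intertwine_derivation (expEquiv (n := n) l c).toAlgHom (eulerDer n a)
      (eulerDer n a + c • downDer 𝕜 n) fun p hp => by
        change expEquiv l c _ = (eulerDer n a + c • downDer 𝕜 n) (expEquiv l c p)
        rw [expEquiv_apply _ _ hp, expEquiv_apply _ _ (eulerDer_mem a hp), Derivation.map_smul]
        rw [Derivation.add_apply, eulerDer_expDown, Derivation.smul_apply, sub_add_cancel]
    rw [bracket, map_sub, map_mul, map_mul, hD, hD, hE, hE, bracket]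
    simp only [Derivation.add_apply, Derivation.smul_apply, mul_add, add_mul, mul_smul_comm,
      smul_mul_assoc]
    ring
  · rw [expEquiv_apply l c hp]
    exact Submodule.smul_mem _ _ (series_mem _ hp)

/-- The homomorphism `(l, c) ↦ (X_j ↦ l exp(c Δ) X_j)`. -/
def expHom (n : ℕ) (a : 𝕜) : 𝕜ˣ × Multiplicative 𝕜 →* gradedPoissonAut n a where
  toFun x := ⟨expEquiv x.1 x.2.toAdd, expEquiv_mem a _ _⟩
  map_one' := Subtype.ext (algEquiv_ext_linearForms fun p hp => by
    simp [expEquiv_apply _ _ hp, expDown_zero])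
  map_mul' x y := Subtype.ext (algEquiv_ext_linearForms fun p hp => by
    have hp' : expDown y.2.toAdd p ∈ linearForms 𝕜 n := series_mem _ hp
    rw [Subgroup.coe_mul, AlgEquiv.mul_apply, expEquiv_apply _ _ hp, expEquiv_apply _ _ hp, map_smul,
      expEquiv_apply _ _ hp', Prod.snd_mul, toAdd_mul, expDown_add, Prod.fst_mul, Units.val_mul,
      mul_comm, mul_smul])

theorem expHom_bijective {a : 𝕜} (h : 2 ≤ n ∨ (n = 1 ∧ a ≠ 0)) :
    Function.Bijective (expHom n a) := by
  have hn : 1 ≤ n := by omega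
  constructor
  · rw [injective_iff_map_eq_one]
    rintro ⟨l, c⟩ hlc
    have hlc' (p : Poly 𝕜 n) (hp : p ∈ linearForms 𝕜 n) : (l : 𝕜) • expDown c.toAdd p = p := by
      rw [← expEquiv_apply _ _ hp]
      exact DFunLike.congr_fun (congrArg Subtype.val hlc) p
    have h0 := congrArg (coord 0) (hlc' _ (var_mem 0))
    have h1 := congrArg (coord 0) (hlc' _ (var_mem 1))
    rw [expDown_var_zero, map_smul, coord_var (Nat.zero_le n), if_pos rfl, smul_eq_mul, mul_one]
      at h0
    rw [h0, one_smul, expDown_var_one hn, map_add, map_smul, coord_var hn,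
      coord_var (Nat.zero_le n)] at h1
    simp only [zero_ne_one, if_false, if_true, zero_add, smul_eq_mul, mul_one] at h1
    exact Prod.ext (Units.ext h0) h1
  · rintro ⟨ψ, hψ⟩
    obtain ⟨l, hl⟩ := poisson_map_var_zero (fun p => hψ.2 1 p) hψ.1 h
    obtain ⟨m, c, hmc⟩ := poisson_map_var_one (fun p => hψ.2 1 p) hψ.1 h
    have hl0 : l ≠ 0 := by
      rintro rfl
      rw [zero_smul] at hl
      exact var_ne_zero (Nat.zero_le n) ((map_eq_zero_iff ψ ψ.injective).1 hl)
    set x : 𝕜ˣ × Multiplicative 𝕜 := ((Units.mk0 l hl0)⁻¹, Multiplicative.ofAdd (-c / l)) with hx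
    set χ := (⟨ψ, hψ⟩ : gradedPoissonAut n a) * expHom n a x with hχ
    have hχapp {p : Poly 𝕜 n} (hp : p ∈ linearForms 𝕜 n) :
        (χ : Poly 𝕜 n ≃ₐ[𝕜] Poly 𝕜 n) p = l⁻¹ • ψ (expDown (-c / l) p) := by
      rw [hχ, Subgroup.coe_mul, AlgEquiv.mul_apply, ← map_smul]
      exact congrArg ψ (expEquiv_apply _ _ hp)
    have hχ1 : χ = 1 := by
      refine Subtype.ext (algEquiv_ext_linearForms fun p hp =>
        poisson_eq_self (fun p => χ.2.2 1 p) χ.2.1 h (m := l⁻¹ * m) ?_ ?_ hp)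
      · rw [hχapp (var_mem 0), expDown_var_zero, hl, smul_smul, inv_mul_cancel₀ hl0, one_smul]
      · rw [hχapp (var_mem 1), expDown_var_one hn, map_add, map_smul, hl, hmc, smul_smul,
          div_mul_cancel₀ _ hl0, add_assoc, ← add_smul, add_neg_cancel, zero_smul, add_zero,
          smul_smul]
    exact ⟨x⁻¹, by rw [map_inv, eq_comm, eq_inv_iff_mul_eq_one]; exact hχ1⟩

end Poisson

end

section

variable {𝕜 : Type*} [Field 𝕜] {n : ℕ}

/-! ### Generation of `R(n,a)` by the variables -/

namespace R

theorem x_eq_of_var (a : 𝕜) (i : Fin (n + 1)) : x a i = of a (var 𝕜 n i) := by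
  rw [x, X_eq_var]

variable [CharZero 𝕜]

/-- A subspace that contains `1` and is stable under left multiplication by the generators is
everything. -/
theorem submodule_eq_top {a : 𝕜} (W : Submodule 𝕜 (R n a)) (h1 : (1 : R n a) ∈ W)
    (h : ∀ (i : Fin (n + 1)) (f : R n a), f ∈ W → x a i * f ∈ W) : W = ⊤ := by
  have hmon (s : Fin (n + 1) →₀ ℕ) (c : 𝕜) : of a (monomial s c) ∈ W ∧
      ∃ z : 𝕜, eulerDer n a (monomial s c) = z • (monomial s c : Poly 𝕜 n) := by
    refine induction_on_monomial (motive := fun p => of a p ∈ W ∧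
      ∃ z : 𝕜, eulerDer n a p = z • p) (fun c => ⟨?_, 0, by simp⟩) (fun p i hp => ?_) s c
    · rw [← mul_one (C c), ← smul_eq_C_mul, map_smul, of_one]
      exact W.smul_mem c h1
    · obtain ⟨hpW, z, hz⟩ := hp
      refine ⟨?_, _, eulerDer_mul hz (mkDerivation_X _ _ i)⟩
      rw [X_eq_var, mul_comm]
      have hi := i.2
      generalize (i : ℕ) = j at hi
      induction j using Nat.strong_induction_on with
      | _ j ih =>
        have h2 := h ⟨j, hi⟩ _ hpW
        rw [x_eq_of_var, ← of_star, star_eq_phi_mul _ hz, phi_var z (by simpa using Nat.lt_succ_iff.1 hi),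
          Finset.sum_range_succ', add_mul, Finset.sum_mul, map_add, map_sum, binom_zero, one_smul,
          Nat.sub_zero] at h2
        refine (W.add_mem_iff_right (W.sum_mem fun k hk => ?_)).1 h2
        rw [smul_mul_assoc, map_smul]
        have hk' : k < j := Finset.mem_range.1 hk
        exact W.smul_mem _ (ih (j - (k + 1)) (by omega) (by omega))
  rw [eq_top_iff]
  intro f _
  obtain ⟨p, rfl⟩ := (of a).surjective f
  induction p using MvPolynomial.induction_on' with
  | monomial s c => exact (hmon s c).1
  | add p q hp hq => rw [map_add]; exact W.add_mem (hp trivial) (hq trivial)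

theorem subalgebra_eq_top {a : 𝕜} (S : Subalgebra 𝕜 (R n a)) (h : ∀ i, x a i ∈ S) : S = ⊤ := by
  have h1 := submodule_eq_top (Subalgebra.toSubmodule S) S.one_mem
    fun i f hf => S.mul_mem (h i) hf
  exact Subalgebra.toSubmodule_injective (by rw [h1, Algebra.top_toSubmodule])

theorem algEquiv_ext {a : 𝕜} {ψ χ : R n a ≃ₐ[𝕜] R n a}
    (h : ∀ p ∈ linearForms 𝕜 n, ψ (of a p) = χ (of a p)) : ψ = χ := by
  have h1 := subalgebra_eq_top (AlgHom.equalizer ψ.toAlgHom χ.toAlgHom)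
    fun i => h _ (isHomogeneous_X 𝕜 i)
  exact AlgEquiv.ext fun f => (h1 ▸ Algebra.mem_top : f ∈ AlgHom.equalizer ψ.toAlgHom χ.toAlgHom)

theorem of_mem_component {a : 𝕜} {k : ℕ} {p : Poly 𝕜 n} :
    of a p ∈ component a k ↔ p.IsHomogeneous k :=
  ⟨fun ⟨_, hq, h⟩ => (of a).injective h ▸ hq, fun h => ⟨p, h, rfl⟩⟩

/-- The automorphism of `R(n,a)` given by a linear automorphism of the underlying space that is
multiplicative for the product `∗_a`. -/
def autOfLinearEquiv (a : 𝕜) (T : Poly 𝕜 n ≃ₗ[𝕜] Poly 𝕜 n) (h1 : T 1 = 1)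
    (hT : ∀ p q, T (star n a p q) = star n a (T p) (T q)) : R n a ≃ₐ[𝕜] R n a :=
  AlgEquiv.ofLinearEquiv ((of a).symm ≪≫ₗ T ≪≫ₗ of a) (congrArg (of a) h1)
    fun f g => congrArg (of a) (hT ((of a).symm f) ((of a).symm g))

/-- The linear automorphism of the polynomial ring underlying an automorphism of `R(n,a)`. -/
def toLinearEquiv {a : 𝕜} (ψ : R n a ≃ₐ[𝕜] R n a) : Poly 𝕜 n ≃ₗ[𝕜] Poly 𝕜 n :=
  of a ≪≫ₗ ψ.toLinearEquiv ≪≫ₗ (of a).symm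

theorem of_toLinearEquiv {a : 𝕜} (ψ : R n a ≃ₐ[𝕜] R n a) (p : Poly 𝕜 n) :
    of a (toLinearEquiv ψ p) = ψ (of a p) := rfl

theorem toLinearEquiv_star {a : 𝕜} (ψ : R n a ≃ₐ[𝕜] R n a) (p q : Poly 𝕜 n) :
    toLinearEquiv ψ (star n a p q) = star n a (toLinearEquiv ψ p) (toLinearEquiv ψ q) :=
  map_mul ψ (of a p) (of a q)

theorem toLinearEquiv_mem {a : 𝕜} {ψ : R n a ≃ₐ[𝕜] R n a} (hψ : ψ ∈ gradedAut n a) (p : Poly 𝕜 n) :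
    toLinearEquiv ψ p ∈ linearForms 𝕜 n ↔ p ∈ linearForms 𝕜 n := by
  have h := hψ 1 (of a p)
  rwa [← of_toLinearEquiv, of_mem_component, of_mem_component] at h

end R

variable [CharZero 𝕜]

/-! ### The graded automorphisms of `R(n,a)` -/

/-- The substitution `X_j ↦ l X_j`. -/
def scaleEquiv (l : 𝕜ˣ) : Poly 𝕜 n ≃ₐ[𝕜] Poly 𝕜 n := expEquiv l 0

theorem scaleEquiv_apply (l : 𝕜ˣ) {p : Poly 𝕜 n} (hp : p ∈ linearForms 𝕜 n) :
    scaleEquiv l p = (l : 𝕜) • p := by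
  rw [scaleEquiv, expEquiv_apply l 0 hp, expDown_zero]

theorem scaleEquiv_downDer (l : 𝕜ˣ) (f : Poly 𝕜 n) :
    scaleEquiv l (downDer 𝕜 n f) = downDer 𝕜 n (scaleEquiv l f) :=
  intertwine_derivation (scaleEquiv (n := n) l).toAlgHom _ _ (fun p hp => by
    change scaleEquiv l _ = downDer 𝕜 n (scaleEquiv l p)
    rw [scaleEquiv_apply l hp, scaleEquiv_apply l (downDer_mem hp), Derivation.map_smul]) f

theorem scaleEquiv_eulerDer (a : 𝕜) (l : 𝕜ˣ) (f : Poly 𝕜 n) :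
    scaleEquiv l (eulerDer n a f) = eulerDer n a (scaleEquiv l f) :=
  intertwine_derivation (scaleEquiv (n := n) l).toAlgHom _ _ (fun p hp => by
    change scaleEquiv l _ = eulerDer n a (scaleEquiv l p)
    rw [scaleEquiv_apply l hp, scaleEquiv_apply l (eulerDer_mem a hp), Derivation.map_smul]) f

theorem scaleEquiv_downPow (l : 𝕜ˣ) (k : ℕ) (f : Poly 𝕜 n) :
    scaleEquiv l (downPow n k f) = downPow n k (scaleEquiv l f) := by
  induction k with
  | zero => rfl
  | succ k ih => rw [downPow_succ, downPow_succ, scaleEquiv_downDer, ih]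

theorem scaleEquiv_star (a : 𝕜) (l : 𝕜ˣ) (f g : Poly 𝕜 n) :
    scaleEquiv l (star n a f g) = star n a (scaleEquiv l f) (scaleEquiv l g) := by
  induction g using MvPolynomial.induction_on' with
  | add p q hp hq => simp only [star_add, map_add, hp, hq]
  | monomial s c =>
    obtain ⟨z, hz⟩ := exists_eulerDer_monomial a s
    have hz' : eulerDer n a (scaleEquiv l (monomial s c)) = z • scaleEquiv l (monomial s c) := by
      rw [← scaleEquiv_eulerDer, hz c, map_smul]
    obtain ⟨N, hN⟩ := exists_downPow_eq_zero f
    have hN' : downPow n N (scaleEquiv l f) = 0 := by rw [← scaleEquiv_downPow, hN, map_zero]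
    rw [star_eigen hN (hz c), star_eigen hN' hz', map_mul, phiTrunc, phiTrunc, map_sum]
    simp only [map_smul, scaleEquiv_downPow]

/-- The operator `(1 + Δ)^c` as a linear automorphism. -/
def phiEquiv (c : 𝕜) : Poly 𝕜 n ≃ₗ[𝕜] Poly 𝕜 n :=
  LinearEquiv.ofLinearMap (phi c) (phi (-c)) (LinearMap.ext (phi_phi_neg c))
    (LinearMap.ext (phi_neg_phi c))

/-- The automorphism `X_j ↦ l (1 + Δ)^c X_j` of `R(n,a)`. -/
def starAut (n : ℕ) (a : 𝕜) (l : 𝕜ˣ) (c : 𝕜) : R n a ≃ₐ[𝕜] R n a :=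
  R.autOfLinearEquiv a (phiEquiv c ≪≫ₗ (scaleEquiv l).toLinearEquiv)
    ((congrArg (scaleEquiv l) (phi_apply_one c)).trans (map_one _))
    fun p q => (congrArg (scaleEquiv l) (phi_star a c p q)).trans (scaleEquiv_star a l _ _)

theorem starAut_of (a : 𝕜) (l : 𝕜ˣ) (c : 𝕜) {p : Poly 𝕜 n} (hp : p ∈ linearForms 𝕜 n) :
    starAut n a l c (R.of a p) = R.of a ((l : 𝕜) • phi c p) :=
  congrArg (R.of a) (scaleEquiv_apply l (phi_mem c hp))

theorem starAut_mem (a : 𝕜) (l : 𝕜ˣ) (c : 𝕜) : starAut n a l c ∈ gradedAut n a := by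
  intro k f
  obtain ⟨p, rfl⟩ := (R.of a).surjective f
  change R.of a (scaleEquiv l (phi c p)) ∈ _ ↔ _
  rw [R.of_mem_component, R.of_mem_component, scaleEquiv, (expEquiv_mem 0 l 0).2 k (phi c p)]
  exact isHomogeneous_iff_of_injective (T := phi c) (phiEquiv c).injective
    (fun k f hf => isHomogeneous_series _ hf) k p

/-- The homomorphism `(l, c) ↦ (X_j ↦ l (1 + Δ)^c X_j)`. -/
def starHom (n : ℕ) (a : 𝕜) : 𝕜ˣ × Multiplicative 𝕜 →* gradedAut n a where
  toFun x := ⟨starAut n a x.1 x.2.toAdd, starAut_mem a _ _⟩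
  map_one' := Subtype.ext (R.algEquiv_ext fun p hp => by
    simp [starAut_of _ _ _ hp, phi_zero])
  map_mul' x y := Subtype.ext (R.algEquiv_ext fun p hp => by
    have hp' := phi_mem y.2.toAdd hp
    rw [Subgroup.coe_mul, AlgEquiv.mul_apply, starAut_of _ _ _ hp, starAut_of _ _ _ hp,
      map_smul (R.of a), map_smul (R.of a), map_smul, starAut_of _ _ _ hp', Prod.snd_mul, toAdd_mul,
      phi_add, Prod.fst_mul, Units.val_mul, map_smul, mul_comm, mul_smul])

theorem starHom_bijective {a : 𝕜} (h : 2 ≤ n ∨ (n = 1 ∧ a ≠ 0)) :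
    Function.Bijective (starHom n a) := by
  have hn : 1 ≤ n := by omega
  constructor
  · rw [injective_iff_map_eq_one]
    rintro ⟨l, c⟩ hlc
    have hlc' (p : Poly 𝕜 n) (hp : p ∈ linearForms 𝕜 n) : (l : 𝕜) • phi c.toAdd p = p := by
      apply (R.of a).injective
      rw [← starAut_of _ _ _ hp]
      exact DFunLike.congr_fun (congrArg Subtype.val hlc) (R.of a p)
    have h0 := congrArg (coord 0) (hlc' _ (var_mem 0))
    have h1 := congrArg (coord 0) (hlc' _ (var_mem 1))
    rw [phi_var_zero, map_smul, coord_var (Nat.zero_le n), if_pos rfl, smul_eq_mul, mul_one]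
      at h0
    rw [h0, one_smul, phi_var_one hn, map_add, map_smul, coord_var hn,
      coord_var (Nat.zero_le n)] at h1
    simp only [zero_ne_one, if_false, if_true, zero_add, smul_eq_mul, mul_one] at h1
    exact Prod.ext (Units.ext h0) h1
  · rintro ⟨ψ, hψ⟩
    set T := R.toLinearEquiv ψ with hT
    obtain ⟨l, hl⟩ := star_map_var_zero (R.toLinearEquiv_mem hψ) (R.toLinearEquiv_star ψ) h
    obtain ⟨m, c, hmc⟩ := star_map_var_one (R.toLinearEquiv_mem hψ) (R.toLinearEquiv_star ψ) h
    rw [← hT] at hl hmc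
    have hl0 : l ≠ 0 := by
      rintro rfl
      rw [zero_smul] at hl
      exact var_ne_zero (Nat.zero_le n) ((map_eq_zero_iff T T.injective).1 hl)
    set x : 𝕜ˣ × Multiplicative 𝕜 := ((Units.mk0 l hl0)⁻¹, Multiplicative.ofAdd (-c / l)) with hx
    set χ := (⟨ψ, hψ⟩ : gradedAut n a) * starHom n a x with hχ
    have hχapp {p : Poly 𝕜 n} (hp : p ∈ linearForms 𝕜 n) :
        R.toLinearEquiv (χ : R n a ≃ₐ[𝕜] R n a) p = l⁻¹ • T (phi (-c / l) p) := by
      apply (R.of a).injective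
      rw [R.of_toLinearEquiv, hχ, Subgroup.coe_mul, AlgEquiv.mul_apply, ← map_smul T, hT,
        R.of_toLinearEquiv]
      exact congrArg ψ (starAut_of _ _ _ hp)
    have hχ1 : χ = 1 := by
      refine Subtype.ext (R.algEquiv_ext fun p hp => congrArg (R.of a)
        (star_eq_self (R.toLinearEquiv_mem χ.2) (R.toLinearEquiv_star χ.1) h (m := l⁻¹ * m)
          ?_ ?_ hp))
      · rw [hχapp (var_mem 0), phi_var_zero, hl, smul_smul, inv_mul_cancel₀ hl0, one_smul]
      · rw [hχapp (var_mem 1), phi_var_one hn, map_add, map_smul, hl, hmc, smul_smul,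
          div_mul_cancel₀ _ hl0, add_assoc, ← add_smul, add_neg_cancel, zero_smul, add_zero,
          smul_smul]
    exact ⟨x⁻¹, by rw [map_inv, eq_comm, eq_inv_iff_mul_eq_one]; exact hχ1⟩

theorem starAut_x (a : 𝕜) (l : 𝕜ˣ) (c : 𝕜) (j : Fin (n + 1)) :
    starAut n a l c (R.x a j) =
      (l : 𝕜) • ∑ i ∈ Finset.Iic j, binom c ((j : ℕ) - (i : ℕ)) • R.x a i := by
  have hj := Nat.lt_succ_iff.1 j.2
  rw [R.x_eq_of_var, starAut_of _ _ _ (var_mem _), map_smul, phi_var c hj, map_sum]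
  congr 1
  refine (Finset.sum_nbij' (fun i : Fin (n + 1) => (j : ℕ) - i)
    (fun k => (⟨(j : ℕ) - k, by omega⟩ : Fin (n + 1))) ?_ ?_ ?_ ?_ ?_).symm
  · intro i hi
    simp
  · intro k hk
    simp [Fin.le_def]
  · intro i hi
    have : i ≤ j := Finset.mem_Iic.1 hi
    ext
    simp
    omega
  · intro k hk
    have := Finset.mem_range.1 hk
    simp
    omega
  · intro i hi
    have : i ≤ j := Finset.mem_Iic.1 hi
    rw [map_smul, R.x_eq_of_var, Nat.sub_sub_self this]

end

section

variable {𝕜 : Type*} [Field 𝕜] {n : ℕ}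

/-! ### Graded automorphisms of the polynomial ring as matrices -/

/-- The action of a matrix on linear forms. -/
def matrixMap (M : Matrix (Fin (n + 1)) (Fin (n + 1)) 𝕜) : Poly 𝕜 n →ₗ[𝕜] Poly 𝕜 n :=
  ∑ j, ∑ i, M i j • (coord (j : ℕ)).smulRight (var 𝕜 n i)

theorem matrixMap_mem (M : Matrix (Fin (n + 1)) (Fin (n + 1)) 𝕜) (p : Poly 𝕜 n) :
    matrixMap M p ∈ linearForms 𝕜 n := by
  simp only [matrixMap, LinearMap.sum_apply, LinearMap.smul_apply, LinearMap.smulRight_apply]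
  exact Submodule.sum_mem _ fun j _ => Submodule.sum_mem _ fun i _ =>
    Submodule.smul_mem _ _ (Submodule.smul_mem _ _ (var_mem _))

theorem coord_matrixMap (M : Matrix (Fin (n + 1)) (Fin (n + 1)) 𝕜) (i : Fin (n + 1))
    (p : Poly 𝕜 n) :
    (coord (i : ℕ) (matrixMap M p) : 𝕜) = ∑ j : Fin (n + 1), M i j * coord (j : ℕ) p := by
  simp only [matrixMap, LinearMap.sum_apply, LinearMap.smul_apply, LinearMap.smulRight_apply,
    map_sum, map_smul, coord_var (Nat.lt_succ_iff.1 (Fin.is_lt _)), Fin.val_inj, smul_eq_mul,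
    mul_ite, mul_one, mul_zero, Finset.sum_ite_eq, Finset.mem_univ, if_true]

theorem linearForm_ext_fin {p q : Poly 𝕜 n} (hp : p ∈ linearForms 𝕜 n) (hq : q ∈ linearForms 𝕜 n)
    (h : ∀ i : Fin (n + 1), (coord (i : ℕ) p : 𝕜) = coord (i : ℕ) q) : p = q :=
  linearForm_ext hp hq fun i hi => h ⟨i, Nat.lt_succ_iff.2 hi⟩

theorem matrixMap_mul (M N : Matrix (Fin (n + 1)) (Fin (n + 1)) 𝕜) (p : Poly 𝕜 n) :
    matrixMap M (matrixMap N p) = matrixMap (M * N) p := by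
  refine linearForm_ext_fin (matrixMap_mem _ _) (matrixMap_mem _ _) fun i => ?_
  simp only [coord_matrixMap, Matrix.mul_apply, Finset.mul_sum, Finset.sum_mul]
  rw [Finset.sum_comm]
  simp only [mul_assoc]

theorem matrixMap_one {p : Poly 𝕜 n} (hp : p ∈ linearForms 𝕜 n) : matrixMap 1 p = p := by
  refine linearForm_ext_fin (matrixMap_mem _ _) hp fun i => ?_
  simp [coord_matrixMap, Matrix.one_apply]

/-- The matrix of a graded automorphism of the polynomial ring. -/
def linearMatrix (ψ : Poly 𝕜 n ≃ₐ[𝕜] Poly 𝕜 n) : Matrix (Fin (n + 1)) (Fin (n + 1)) 𝕜 :=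
  fun i j => coord (i : ℕ) (ψ (var 𝕜 n j))

theorem apply_eq_matrixMap (ψ : polyGradedAut 𝕜 n) {p : Poly 𝕜 n} (hp : p ∈ linearForms 𝕜 n) :
    (ψ : Poly 𝕜 n ≃ₐ[𝕜] Poly 𝕜 n) p = matrixMap (linearMatrix ψ) p := by
  refine eqOn_linearForms (A := (ψ : Poly 𝕜 n ≃ₐ[𝕜] Poly 𝕜 n).toLinearMap)
    (B := matrixMap (linearMatrix ψ)) (fun j hj => ?_) hp
  refine linearForm_ext_fin ((ψ.2 1 _).2 (var_mem j)) (matrixMap_mem _ _) fun i => ?_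
  rw [coord_matrixMap, Finset.sum_eq_single ⟨j, Nat.lt_succ_iff.2 hj⟩]
  · simp [coord_var hj, linearMatrix]
  · intro k _ hk
    rw [coord_var hj, if_neg fun h => hk (Fin.ext h), mul_zero]
  · simp

variable (𝕜 n) in
/-- The matrix representation of the graded automorphisms of the polynomial ring. -/
def linearMatrixHom : polyGradedAut 𝕜 n →* Matrix (Fin (n + 1)) (Fin (n + 1)) 𝕜 where
  toFun ψ := linearMatrix (ψ : Poly 𝕜 n ≃ₐ[𝕜] Poly 𝕜 n)
  map_one' := by
    ext i j
    simp [linearMatrix, coord_var (Nat.lt_succ_iff.1 j.2), Matrix.one_apply, Fin.val_inj]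
  map_mul' ψ χ := by
    ext i j
    rw [linearMatrix, Subgroup.coe_mul, AlgEquiv.mul_apply,
      apply_eq_matrixMap ψ ((χ.2 1 _).2 (var_mem _)), coord_matrixMap, Matrix.mul_apply]
    rfl

theorem linearMatrixHom_toHomUnits_bijective :
    Function.Bijective (linearMatrixHom 𝕜 n).toHomUnits := by
  constructor
  · intro ψ χ h
    have h1 : linearMatrix (ψ : Poly 𝕜 n ≃ₐ[𝕜] Poly 𝕜 n) = linearMatrix χ :=
      congrArg Units.val h
    refine Subtype.ext (algEquiv_ext_linearForms fun p hp => ?_)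
    rw [apply_eq_matrixMap ψ hp, apply_eq_matrixMap χ hp, h1]
  · intro g
    let ψ : Poly 𝕜 n ≃ₐ[𝕜] Poly 𝕜 n := linSubstEquiv (matrixMap g.1) (matrixMap (g⁻¹).1)
      (fun p _ => matrixMap_mem _ p) (fun p _ => matrixMap_mem _ p)
      (fun p hp => by rw [matrixMap_mul, Units.mul_inv, matrixMap_one hp])
      (fun p hp => by rw [matrixMap_mul, Units.inv_mul, matrixMap_one hp])
    have hψ {p : Poly 𝕜 n} (hp : p ∈ linearForms 𝕜 n) : ψ p = matrixMap g.1 p :=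
      linSubst_apply _ hp
    refine ⟨⟨ψ, mem_polyGradedAut fun p hp => ?_⟩, Units.ext ?_⟩
    · rw [hψ hp]
      exact matrixMap_mem _ _
    · ext i j
      change coord (i : ℕ) (ψ (var 𝕜 n j)) = _
      rw [hψ (var_mem _), coord_matrixMap, Finset.sum_eq_single j]
      · simp [coord_var (Nat.lt_succ_iff.1 j.2)]
      · intro k _ hk
        rw [coord_var (Nat.lt_succ_iff.1 j.2), if_neg fun h => hk (Fin.ext h), mul_zero]
      · simp

/-! ### The commutative case `n = 1`, `a = 0` -/

theorem eulerDer_one_zero : eulerDer 1 (0 : 𝕜) = (X 1 : Poly 𝕜 1) • pderiv 1 := by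
  refine derivation_ext fun i => ?_
  fin_cases i
  · simp [eulerDer, pderiv_X]
  · simp [eulerDer, pderiv_X]

theorem downDer_one : downDer 𝕜 1 = (X 0 : Poly 𝕜 1) • pderiv 1 := by
  refine derivation_ext fun i => ?_
  fin_cases i
  · simp [downDer, pderiv_X]
  · have : (1 : Fin 2) = Fin.succ 0 := rfl
    simp only [downDer, mkDerivation_X, Fin.mk_one, this, Fin.cases_succ]
    simp [pderiv_X]

theorem bracket_one_zero (f g : Poly 𝕜 1) : bracket 1 0 f g = 0 := by
  rw [bracket, eulerDer_one_zero, downDer_one]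
  simp only [Derivation.smul_apply, smul_eq_mul]
  ring

theorem gradedPoissonAut_one_zero : gradedPoissonAut 1 (0 : 𝕜) = polyGradedAut 𝕜 1 :=
  inf_eq_right.2 fun ψ _ f g => by rw [bracket_one_zero, bracket_one_zero, map_zero]

theorem eulerDer_one_zero_monomial (s : Fin 2 →₀ ℕ) (c : 𝕜) :
    eulerDer 1 (0 : 𝕜) (monomial s c) = (s 1 : 𝕜) • monomial s c := by
  rw [eulerDer_one_zero, Derivation.smul_apply, smul_eq_mul, X_mul_pderiv_monomial, Nat.cast_smul_eq_nsmul]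

variable (𝕜) in
/-- The linear map sending `X_0 ^ p X_1 ^ q` to `X_0 ^ p ∏_{i < q} (X_1 - i X_0)`. -/
def straighten : Poly 𝕜 1 →ₗ[𝕜] Poly 𝕜 1 :=
  (basisMonomials (Fin 2) 𝕜).constr 𝕜 fun s =>
    X 0 ^ s 0 * ∏ i ∈ Finset.range (s 1), (X 1 - (i : 𝕜) • X 0)

theorem straighten_monomial (s : Fin 2 →₀ ℕ) (c : 𝕜) : straighten 𝕜 (monomial s c) =
    c • (X 0 ^ s 0 * ∏ i ∈ Finset.range (s 1), (X 1 - (i : 𝕜) • X 0)) := by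
  have h := (basisMonomials (Fin 2) 𝕜).constr_basis 𝕜 (fun s =>
    (X 0 ^ s 0 * ∏ i ∈ Finset.range (s 1), (X 1 - (i : 𝕜) • X 0) : Poly 𝕜 1)) s
  rw [coe_basisMonomials] at h
  rw [← mul_one c, ← smul_eq_mul, ← smul_monomial, map_smul, straighten, h, smul_eq_mul, mul_one]

theorem straighten_isHomogeneous {k : ℕ} {f : Poly 𝕜 1} (hf : f.IsHomogeneous k) :
    (straighten 𝕜 f).IsHomogeneous k := by
  rw [f.as_sum, map_sum]
  refine IsHomogeneous.sum _ _ _ fun s hs => ?_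
  have hdeg : k = 1 * s 0 + ∑ _i ∈ Finset.range (s 1), 1 := by
    have h1 := hf.degree_eq_sum_deg_support hs
    rw [Finset.sum_const, Finset.card_range, smul_eq_mul, mul_one, one_mul, h1]
    exact (Finset.sum_subset (Finset.subset_univ _) fun i _ hi =>
      Finsupp.notMem_support_iff.1 hi).trans (Fin.sum_univ_two _)
  rw [straighten_monomial, hdeg]
  refine Submodule.smul_mem (homogeneousSubmodule _ _ _) _ (IsHomogeneous.mul
    ((isHomogeneous_X _ _).pow _) (IsHomogeneous.prod _ _ _ fun i _ => ?_))
  exact sub_mem (isHomogeneous_X 𝕜 1) (Submodule.smul_mem (linearForms 𝕜 1) _ (isHomogeneous_X 𝕜 0))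

theorem straighten_one : straighten 𝕜 1 = 1 := by
  rw [← C_1, C_apply, straighten_monomial]
  simp

theorem X_mul_monomial {σ : Type*} (i : σ) (s : σ →₀ ℕ) (c : 𝕜) :
    X i * monomial s c = monomial (Finsupp.single i 1 + s) c := by
  rw [X, monomial_mul, one_mul]

theorem straighten_var_zero_mul (f : Poly 𝕜 1) :
    straighten 𝕜 (X 0 * f) = X 0 * straighten 𝕜 f := by
  induction f using MvPolynomial.induction_on' with
  | add p q hp hq => simp only [mul_add, map_add, hp, hq]
  | monomial s c =>
    rw [X_mul_monomial, straighten_monomial, straighten_monomial]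
    simp [pow_add, mul_assoc]

theorem straighten_var_one_mul (f : Poly 𝕜 1) :
    straighten 𝕜 (X 1 * f + X 0 * eulerDer 1 0 f) = X 1 * straighten 𝕜 f := by
  induction f using MvPolynomial.induction_on' with
  | add p q hp hq =>
    have h : X 1 * (p + q) + X 0 * eulerDer 1 0 (p + q) =
        X 1 * p + X 0 * eulerDer 1 0 p + (X 1 * q + X 0 * eulerDer 1 0 q) := by
      rw [map_add]
      ring
    rw [h, map_add, hp, hq, map_add, mul_add]
  | monomial s c =>
    rw [map_add, straighten_var_zero_mul, eulerDer_one_zero_monomial, map_smul, X_mul_monomial,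
      straighten_monomial, straighten_monomial, Finsupp.add_apply, Finsupp.add_apply,
      Finsupp.single_eq_same, Finsupp.single_eq_of_ne (show (0 : Fin 2) ≠ 1 by decide), zero_add,
      add_comm 1 (s 1), Finset.prod_range_succ]
    simp only [smul_eq_C_mul]
    ring

section CharZero

variable [CharZero 𝕜]

/-- `straighten` is an algebra homomorphism for the product of `R(1,0)`. -/
theorem straighten_star (f g : Poly 𝕜 1) :
    straighten 𝕜 (star 1 0 f g) = straighten 𝕜 f * straighten 𝕜 g := by
  have hx (i : Fin 2) (f : Poly 𝕜 1) : straighten 𝕜 (star 1 0 (X i) f) = X i * straighten 𝕜 f := by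
    rw [X_eq_var i]
    fin_cases i
    · exact (congrArg _ (var_zero_star 0 f)).trans (straighten_var_zero_mul f)
    · exact (congrArg _ (var_one_star le_rfl 0 f)).trans (straighten_var_one_mul f)
  have hX (i : Fin 2) : straighten 𝕜 (X i) = X i := by
    rw [← star_one 0 (X i), hx, straighten_one, mul_one, star_one]
  let W : Submodule 𝕜 (R 1 (0 : 𝕜)) :=
    { carrier := {f | ∀ g, straighten 𝕜 (star 1 0 ((R.of 0).symm f) g) =
        straighten 𝕜 ((R.of 0).symm f) * straighten 𝕜 g}
      add_mem' := fun {f f'} hf hf' g => by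
        rw [map_add, add_star, map_add, map_add, hf g, hf' g, add_mul]
      zero_mem' := fun g => by rw [map_zero, zero_star, map_zero, zero_mul]
      smul_mem' := fun c f hf g => by
        rw [map_smul, smul_star, map_smul, map_smul, hf g, smul_mul_assoc] }
  have hW : W = ⊤ := by
    refine R.submodule_eq_top W (fun g => ?_) fun i f hf g => ?_
    · change straighten 𝕜 (star 1 0 1 g) = straighten 𝕜 1 * _
      rw [one_star, straighten_one, one_mul]
    · change straighten 𝕜 (star 1 0 (star 1 0 (X i) ((R.of 0).symm f)) g) =
        straighten 𝕜 (star 1 0 (X i) ((R.of 0).symm f)) * _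
      rw [star_assoc, hx, hx, hf g, mul_assoc]
  exact (hW ▸ Submodule.mem_top : R.of 0 f ∈ W) g

variable (𝕜) in
/-- `straighten` as an algebra homomorphism. -/
def straightenHom : R 1 (0 : 𝕜) →ₐ[𝕜] Poly 𝕜 1 :=
  AlgHom.ofLinearMap (straighten 𝕜 ∘ₗ (R.of (0 : 𝕜)).symm.toLinearMap) straighten_one
    fun _ _ => straighten_star _ _

theorem straightenHom_x (i : Fin 2) : straightenHom 𝕜 (R.x 0 i) = X i := by
  change straighten 𝕜 (monomial (Finsupp.single i 1) 1) = X i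
  rw [straighten_monomial]
  fin_cases i <;> simp

theorem x_commute : R.x (0 : 𝕜) (1 : Fin 2) * R.x 0 0 = R.x 0 0 * R.x 0 1 := by
  have h := star_var_zero (0 : 𝕜) (var 𝕜 1 1)
  rw [phi_zero] at h
  exact congrArg (R.of (0 : 𝕜)) h

theorem straightenHom_bijective : Function.Bijective (straightenHom 𝕜) := by
  let H : Poly 𝕜 1 →ₗ[𝕜] R 1 (0 : 𝕜) :=
    (basisMonomials (Fin 2) 𝕜).constr 𝕜 fun s => R.x 0 0 ^ s 0 * R.x 0 1 ^ s 1
  have hH (s : Fin 2 →₀ ℕ) : H (monomial s 1) = R.x 0 0 ^ s 0 * R.x 0 1 ^ s 1 := by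
    have h := (basisMonomials (Fin 2) 𝕜).constr_basis 𝕜
      (fun s => (R.x 0 0 ^ s 0 * R.x 0 1 ^ s 1 : R 1 (0 : 𝕜))) s
    rwa [coe_basisMonomials] at h
  have hleft (p : Poly 𝕜 1) : straightenHom 𝕜 (H p) = p := by
    refine DFunLike.congr_fun (f := (straightenHom 𝕜).toLinearMap ∘ₗ H) (g := LinearMap.id)
      ((basisMonomials (Fin 2) 𝕜).ext fun s => ?_) p
    rw [coe_basisMonomials, LinearMap.comp_apply, hH, AlgHom.toLinearMap_apply, map_mul, map_pow,
      map_pow, straightenHom_x, straightenHom_x, LinearMap.id_apply]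
    dsimp only
    rw [monomial_eq, C_1, one_mul, Finsupp.prod_fintype _ _ (by simp), Fin.prod_univ_two]
  have hmul (i : Fin 2) (p : Poly 𝕜 1) : R.x 0 i * H p = H (X i * p) := by
    refine DFunLike.congr_fun (f := LinearMap.mulLeft 𝕜 (R.x 0 i) ∘ₗ H)
      (g := H ∘ₗ LinearMap.mulLeft 𝕜 (X i)) ((basisMonomials (Fin 2) 𝕜).ext fun s => ?_) p
    rw [coe_basisMonomials, LinearMap.comp_apply, LinearMap.comp_apply, LinearMap.mulLeft_apply,
      LinearMap.mulLeft_apply, X_mul_monomial, hH, hH]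
    fin_cases i
    · simp [pow_add, mul_assoc]
    · have hc : Commute (R.x (0 : 𝕜) (1 : Fin 2)) (R.x 0 0 ^ s 0) :=
        Commute.pow_right x_commute _
      simp only [Fin.mk_one, Finsupp.add_apply, Finsupp.single_eq_same,
        Finsupp.single_eq_of_ne (show (0 : Fin 2) ≠ 1 by decide), zero_add, pow_add, pow_one]
      rw [← mul_assoc, hc.eq, mul_assoc]
  have hsurj : LinearMap.range H = ⊤ := by
    refine R.submodule_eq_top _ ⟨monomial 0 1, (hH 0).trans (by simp)⟩ ?_
    rintro i _ ⟨p, rfl⟩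
    exact ⟨X i * p, (hmul i p).symm⟩
  refine ⟨fun f g hfg => ?_, fun p => ⟨H p, hleft p⟩⟩
  obtain ⟨p, rfl⟩ := LinearMap.range_eq_top.1 hsurj f
  obtain ⟨q, rfl⟩ := LinearMap.range_eq_top.1 hsurj g
  rw [← hleft p, hfg, hleft q]

variable (𝕜) in
/-- The isomorphism of `R(1,0)` with the commutative polynomial ring. -/
def straightenEquiv : R 1 (0 : 𝕜) ≃ₐ[𝕜] Poly 𝕜 1 :=
  AlgEquiv.ofBijective (straightenHom 𝕜) straightenHom_bijective

theorem straightenEquiv_isHomogeneous (k : ℕ) (f : R 1 (0 : 𝕜)) :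
    (straightenEquiv 𝕜 f).IsHomogeneous k ↔ f ∈ R.component 0 k := by
  obtain ⟨p, rfl⟩ := (R.of (0 : 𝕜)).surjective f
  rw [R.of_mem_component]
  exact isHomogeneous_iff_of_injective (T := straighten 𝕜) straightenHom_bijective.1
    (fun _ _ hf => straighten_isHomogeneous hf) k p

theorem map_gradedAut_straightenEquiv :
    (gradedAut 1 (0 : 𝕜)).map (straightenEquiv 𝕜).autCongr.toMonoidHom = polyGradedAut 𝕜 1 := by
  have key (ψ : R 1 (0 : 𝕜) ≃ₐ[𝕜] R 1 (0 : 𝕜)) :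
      (straightenEquiv 𝕜).autCongr ψ ∈ polyGradedAut 𝕜 1 ↔ ψ ∈ gradedAut 1 (0 : 𝕜) := by
    refine forall_congr' fun k => ⟨fun h f => ?_, fun h f => ?_⟩
    · have h1 := h (straightenEquiv 𝕜 f)
      rw [straightenEquiv_isHomogeneous, AlgEquiv.autCongr_apply] at h1
      simpa [straightenEquiv_isHomogeneous] using h1
    · have h1 := h ((straightenEquiv 𝕜).symm f)
      rw [← straightenEquiv_isHomogeneous, ← straightenEquiv_isHomogeneous,
        AlgEquiv.apply_symm_apply] at h1
      exact h1
  ext χ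
  obtain ⟨ψ, rfl⟩ := (straightenEquiv 𝕜).autCongr.surjective χ
  rw [key]
  constructor
  · rintro ⟨ψ', hψ', h⟩
    rwa [← (straightenEquiv 𝕜).autCongr.injective h]
  · exact fun h => ⟨ψ, h, rfl⟩

end CharZero

end

end PymAlgebra

end

open PymAlgebra in
theorem theorem4p8 (𝕜 : Type*) [Field 𝕜] [CharZero 𝕜] :
    (∀ (n : ℕ) (a : 𝕜), (2 ≤ n ∨ (n = 1 ∧ a ≠ 0)) →
      (∃ (ξ : 𝕜ˣ → (R n a ≃ₐ[𝕜] R n a)) (φ : 𝕜 → (R n a ≃ₐ[𝕜] R n a)),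
        (∀ (l : 𝕜ˣ) (j : Fin (n + 1)), ξ l (R.x a j) = (l : 𝕜) • R.x a j) ∧
        (∀ (c : 𝕜) (j : Fin (n + 1)),
          φ c (R.x a j) = ∑ i ∈ Finset.Iic j, binom c ((j : ℕ) - (i : ℕ)) • R.x a i) ∧
        (∀ ψ : R n a ≃ₐ[𝕜] R n a, ψ ∈ gradedAut n a ↔ ∃ (l : 𝕜ˣ) (c : 𝕜), ψ = ξ l * φ c) ∧
        (∃ Θ : 𝕜ˣ × Multiplicative 𝕜 ≃* gradedAut n a,
          ∀ (l : 𝕜ˣ) (c : 𝕜), (Θ (l, Multiplicative.ofAdd c) : R n a ≃ₐ[𝕜] R n a) = ξ l * φ c)) ∧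
      Nonempty (gradedPoissonAut n a ≃* 𝕜ˣ × Multiplicative 𝕜) ∧
      Nonempty (gradedPoissonAut n a ≃* gradedAut n a)) ∧
    (gradedPoissonAut 1 (0 : 𝕜) = polyGradedAut 𝕜 1 ∧
      (∃ e : R 1 (0 : 𝕜) ≃ₐ[𝕜] Poly 𝕜 1,
        (∀ j, e (R.x 0 j) = MvPolynomial.X j) ∧
        (gradedAut 1 (0 : 𝕜)).map e.autCongr.toMonoidHom = polyGradedAut 𝕜 1) ∧
      Nonempty (polyGradedAut 𝕜 1 ≃* GL (Fin 2) 𝕜)) := by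
  refine ⟨fun n a h => ?_, gradedPoissonAut_one_zero,
    ⟨straightenEquiv 𝕜, straightenHom_x, map_gradedAut_straightenEquiv⟩,
    ⟨MulEquiv.ofBijective _ linearMatrixHom_toHomUnits_bijective⟩⟩
  let Θ := MulEquiv.ofBijective _ (starHom_bijective h)
  let P := MulEquiv.ofBijective _ (expHom_bijective h)
  have hΘ (l : 𝕜ˣ) (c : 𝕜) : (Θ (l, Multiplicative.ofAdd c) : R n a ≃ₐ[𝕜] R n a) =
      starAut n a l 0 * starAut n a 1 c := by
    have h1 : ((l, Multiplicative.ofAdd c) : 𝕜ˣ × Multiplicative 𝕜) =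
        (l, 1) * (1, Multiplicative.ofAdd c) := by
      rw [Prod.mk_mul_mk, mul_one, one_mul]
    rw [h1, map_mul]
    rfl
  refine ⟨⟨fun l => starAut n a l 0, fun c => starAut n a 1 c, fun l j => ?_, fun c j => ?_,
    fun ψ => ⟨fun hψ => ?_, ?_⟩, Θ, hΘ⟩, ⟨P.symm⟩, ⟨P.symm.trans Θ⟩⟩
  · rw [R.x_eq_of_var, starAut_of _ _ _ (var_mem _), phi_zero, map_smul]
  · rw [starAut_x, Units.val_one, one_smul]
  · obtain ⟨⟨l, c⟩, hlc⟩ := Θ.surjective ⟨ψ, hψ⟩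
    refine ⟨l, c.toAdd, ?_⟩
    rw [← hΘ, ofAdd_toAdd, hlc]
  · rintro ⟨l, c, rfl⟩
    exact mul_mem (starAut_mem _ _ _) (starAut_mem _ _ _)
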